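/- Let $n\ge 0$, let $\omega$ be the standard symplectic form on $\mathbb R^{2n+2}$, let $0\ne A\in\mathfrak{sp}(n+1,\mathbb R)$ (so $\omega(Ax,y)=-\omega(x,Ay)$), $H(x)=\omega(x,Ax)$, let $\mu_0\in\mathbb R$, $\mu_0\neq 0$, and let $\Sigma=\{x\in\mathbb R^{2n+2} : H(x)=\mu_0\}$, a closed embedded hypersurface. Let $\psi_t=\exp(-2tA)$ be the flow of the Hamiltonian vector field $X_H(x)=-2Ax$, let $M=\Sigma/\psi_t$ be the orbit space with the quotient topology and $\pi:\Sigma\to M$ the projection, and assume that $M$ is a (Hausdorff) smooth manifold of dimension $2n$ for which $\pi$ is a smooth submersion. For $x\in\Sigma$ let $H_x=\{v\in T_x\Sigma : \omega(v,x)=\omega(v,Ax)=0\}$. Then $\pi_{*x}:H_x\to T_{\pi(x)}M$ is a linear isomorphism; for a tangent vector or a vector field $Y$ on $M$ let $\bar Y$ be its lift to $H_x$. With the flat connection $D$ of $\mathbb R^{2n+2}$, let $\nabla$ be the connection on $\Sigma$ given by $$(\nabla_YZ)_x=(D_YZ)_x+\tfrac1{\mu_0}\,\omega(Z,AY)\,x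 .$$ Then there are well-defined objects on $M$ characterized, at all $x\in\Sigma$ with $y=\pi(x)$, by $$\Omega_y(Y,Z)=\omega(\bar Y,\bar Z),\qquad \overline{A_yU}=A\bar U-\tfrac1{\mu_0}\,\omega(A\bar U,Ax)\,x,\qquad \overline{\nabla^r_YZ}=\nabla_{\bar Y}\bar Z+\tfrac1{\mu_0}\,\omega(\bar Y,\bar Z)\,Ax .$$ $\Omega$ is a symplectic form on $M$, $\nabla^r$ (the reduced connection) is a symplectic connection on $(M,\Omega)$, that is, torsion free with $\Omega$ parallel, $A_y$ lies in the symplectic Lie algebra of $(T_yM,\Omega_y)$, and the curvature tensor $R^r(Y,Z)T=\nabla^r_Y\nabla^r_ZT-\nabla^r_Z\nabla^r_YT-\nabla^r_{[Y,Z]}T$ of $\nabla^r$ is of Ricci type. Explicitly, $$R^r_y(Y,Z)T=\tfrac1{\mu_0}\big[\Omega(Z,T)A_yY-\Omega(Y,T)A_yZ-2\,\Omega(Y,Z)A_yT+\Omega(T,A_yZ)Y-\Omega(T,A_yY)Z\big].$$ Here the curvature $R$ of a symplectic connection on a $2n$-dimensional symplectic manifold is of Ricci type if it equals the component determined by its Ricci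 tensor $r(X,Y)=\operatorname{tr}(Z\mapsto R(X,Z)Y)$, that is, if for all $X,Y,Z,T$ $$\Omega(R(X,Y)Z,T)=-\tfrac{1}{2(n+1)}\big[2\,\Omega(X,Y)r(Z,T)+\Omega(X,Z)r(Y,T)+\Omega(X,T)r(Y,Z)-\Omega(Y,Z)r(X,T)-\Omega(Y,T)r(X,Z)\big].$$ -/

import Mathlib

open scoped Manifold ContDiff Matrix

noncomputable section

namespace SymplecticReduction

/-! ### The standard symplectic vector space, the quadric and the flow -/

/-- The vector space `ℝ^{2n+2}`, with coordinates `(p, q) ∈ ℝ^{n+1} × ℝ^{n+1}`. -/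
abbrev Phase (n : ℕ) : Type := Fin (n + 1) ⊕ Fin (n + 1) → ℝ

/-- The Lie algebra `sp(n+1, ℝ)`, as matrices. -/
abbrev Sp (n : ℕ) := LieAlgebra.Symplectic.sp (Fin (n + 1)) ℝ

/-- The standard symplectic form `ω(x, y) = ∑ (pᵢ(x) qᵢ(y) - qᵢ(x) pᵢ(y))`. -/
def omega {n : ℕ} : Phase n →ₗ[ℝ] Phase n →ₗ[ℝ] ℝ :=
  LinearMap.mk₂ ℝ
    (fun x y => ∑ i, (x (Sum.inl i) * y (Sum.inr i) - x (Sum.inr i) * y (Sum.inl i)))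
    (fun x x' y => by
      rw [← Finset.sum_add_distrib]; exact Finset.sum_congr rfl fun i _ => by simp; ring)
    (fun c x y => by
      rw [smul_eq_mul, Finset.mul_sum]; exact Finset.sum_congr rfl fun i _ => by simp; ring)
    (fun x y y' => by
      rw [← Finset.sum_add_distrib]; exact Finset.sum_congr rfl fun i _ => by simp; ring)
    (fun c x y => by
      rw [smul_eq_mul, Finset.mul_sum]; exact Finset.sum_congr rfl fun i _ => by simp; ring)

variable {n : ℕ}

lemma omega_apply (x y : Phase n) :
    omega x y = ∑ i, (x (Sum.inl i) * y (Sum.inr i) - x (Sum.inr i) * y (Sum.inl i)) := rfl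

lemma omega_neg_swap (x y : Phase n) : omega x y = - omega y x := by
  rw [omega_apply, omega_apply, ← Finset.sum_neg_distrib]
  exact Finset.sum_congr rfl fun i _ => by ring

lemma omega_eq_dotProduct (x y : Phase n) :
    omega x y = - (x ⬝ᵥ (Matrix.J (Fin (n + 1)) ℝ *ᵥ y)) := by
  rw [omega_apply, Matrix.J, Matrix.fromBlocks_mulVec, dotProduct, Fintype.sum_sum_type,
    Finset.sum_sub_distrib]
  simp [Matrix.neg_mulVec]
  ring

/-- Elements of `sp(n+1, ℝ)` are exactly the matrices with `ω(Ax, y) = -ω(x, Ay)`; this is the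
direction needed here. -/
lemma omega_mulVec_left (A : Sp n) (x y : Phase n) :
    omega (A.1 *ᵥ x) y = - omega x (A.1 *ᵥ y) := by
  have h : (A.1)ᵀ * Matrix.J (Fin (n + 1)) ℝ = Matrix.J (Fin (n + 1)) ℝ * (-A.1) :=
     (mem_skewAdjointMatricesSubmodule (Matrix.J (Fin (n + 1)) ℝ) A.1).1
      ((mem_skewAdjointMatricesLieSubalgebra (Matrix.J (Fin (n + 1)) ℝ) A.1).1 A.2)
  rw [omega_eq_dotProduct, omega_eq_dotProduct, Matrix.mulVec_mulVec]
  have h2 : (A.1 *ᵥ x) ⬝ᵥ (Matrix.J (Fin (n + 1)) ℝ *ᵥ y)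
      = x ⬝ᵥ (((A.1)ᵀ * Matrix.J (Fin (n + 1)) ℝ) *ᵥ y) := by
    rw [← Matrix.mulVec_mulVec, Matrix.dotProduct_mulVec x, Matrix.vecMul_transpose]
  rw [h2, h]
  simp [Matrix.neg_mulVec]

lemma omega_mulVec_symm (A : Sp n) (x y : Phase n) :
    omega x (A.1 *ᵥ y) = omega y (A.1 *ᵥ x) := by
  rw [omega_neg_swap x, omega_mulVec_left, neg_neg]

/-- The quadratic Hamiltonian `H(x) = ω(x, Ax)`. -/
def ham (A : Sp n) (x : Phase n) : ℝ := omega x (A.1 *ᵥ x)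

/-- The quadric `Σ = {x | ω(x, Ax) = μ₀}`, with the subspace topology. -/
abbrev Quadric (A : Sp n) (μ₀ : ℝ) : Type := {x : Phase n // ham A x = μ₀}

/-- The flow `ψ_t` of the Hamiltonian vector field `X_H(x) = -2Ax`. -/
def flow (A : Sp n) (t : ℝ) (x : Phase n) : Phase n :=
  NormedSpace.exp (t • ((-2 : ℝ) • A.1)) *ᵥ x

lemma flow_zero (A : Sp n) (x : Phase n) : flow A 0 x = x := by
  simp [flow]

lemma flow_add (A : Sp n) (s t : ℝ) (x : Phase n) : flow A (s + t) x = flow A s (flow A t x) := by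
  rw [flow, flow, flow, Matrix.mulVec_mulVec, add_smul, Matrix.exp_add_of_commute]
  exact ((Commute.refl _).smul_left s).smul_right t

/-- The curve `t ↦ ψ_t(x)` is the integral curve of `X_H` through `x`. -/
lemma hasDerivAt_flow (A : Sp n) (x : Phase n) (t : ℝ) :
    HasDerivAt (fun s => flow A s x) ((-2 : ℝ) • (A.1 *ᵥ flow A t x)) t := by
  let _ := Matrix.linftyOpNormedRing (n := Fin (n + 1) ⊕ Fin (n + 1)) (α := ℝ)
  let _ := Matrix.linftyOpNormedAlgebra (R := ℝ) (n := Fin (n + 1) ⊕ Fin (n + 1)) (α := ℝ)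
  have h := hasDerivAt_exp_smul_const' (𝕂 := ℝ) ((-2 : ℝ) • A.1) t
  let L : Matrix (Fin (n + 1) ⊕ Fin (n + 1)) (Fin (n + 1) ⊕ Fin (n + 1)) ℝ →ₗ[ℝ] Phase n :=
    { toFun := fun B => B *ᵥ x
      map_add' := fun B C => Matrix.add_mulVec B C x
      map_smul' := fun c B => Matrix.smul_mulVec c B x }
  have h2 := (LinearMap.toContinuousLinearMap L).hasFDerivAt.comp_hasDerivAt t h
  have e : L ((-2 : ℝ) • A.1 * NormedSpace.exp (t • ((-2 : ℝ) • A.1)))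
      = (-2 : ℝ) • (A.1 *ᵥ flow A t x) := by
    change ((-2 : ℝ) • A.1 * NormedSpace.exp (t • ((-2 : ℝ) • A.1))) *ᵥ x = _
    rw [flow, Matrix.mulVec_mulVec, Matrix.smul_mul, Matrix.smul_mulVec]
  rw [← e]
  exact h2

/-- Two points of the quadric are equivalent when they lie on the same orbit of the flow. -/
def orbitSetoid (A : Sp n) (μ₀ : ℝ) : Setoid (Quadric A μ₀) where
  r x y := ∃ t : ℝ, flow A t x.1 = y.1
  iseqv :=
    { refl := fun x => ⟨0, flow_zero A x.1⟩
      symm := by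
        rintro x y ⟨t, h⟩
        exact ⟨-t, by rw [← h, ← flow_add, neg_add_cancel, flow_zero]⟩
      trans := by
        rintro x y z ⟨t, h⟩ ⟨s, h'⟩
        exact ⟨s + t, by rw [flow_add, h, h']⟩ }

/-- The orbit space `M = Σ / ψ_t`. -/
def Reduced (A : Sp n) (μ₀ : ℝ) : Type := Quotient (orbitSetoid A μ₀)

/-- `M` carries the quotient topology. -/
instance reducedTopology (A : Sp n) (μ₀ : ℝ) : TopologicalSpace (Reduced A μ₀) :=
  inferInstanceAs (TopologicalSpace (Quotient (orbitSetoid A μ₀)))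

/-- The canonical projection `π : Σ → M`. -/
def proj (A : Sp n) (μ₀ : ℝ) (x : Quadric A μ₀) : Reduced A μ₀ :=
  Quotient.mk (orbitSetoid A μ₀) x

/-! ### The manifold structure of the quadric

Near `x ∈ Σ`, the quadric is a graph over the hyperplane `(Ax)^⊥` in the direction of `x`:
the chart at `x` is the projection `y ↦ y - (ω(y, Ax) / μ₀) x`, with inverse
`w ↦ w + √(1 - H(w) / μ₀) x`, followed by a linear isomorphism with `ℝ^{2n+1}`. -/

section Charts

variable (A : Sp n) (μ₀ : ℝ)

/-- The linear form `v ↦ ω(v, Ax)`, which is `dH(x) / 2`. -/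
def ell (x : Phase n) : Phase n →ₗ[ℝ] ℝ := omega.flip (A.1 *ᵥ x)

lemma ell_apply (x v : Phase n) : ell A x v = omega v (A.1 *ᵥ x) := rfl

variable {A μ₀}

lemma ell_self (x : Quadric A μ₀) : ell A x.1 x.1 = μ₀ := x.2

lemma ham_add_smul (x w : Phase n) (s : ℝ) :
    ham A (w + s • x) = ham A w + 2 * s * ell A x w + s ^ 2 * ham A x := by
  simp only [ham, ell_apply, Matrix.mulVec_add, Matrix.mulVec_smul, map_add, map_smul,
    LinearMap.add_apply, LinearMap.smul_apply, smul_eq_mul]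
  rw [omega_mulVec_symm A x w]
  ring

lemma finrank_ker_ell [NeZero μ₀] (x : Quadric A μ₀) :
    Module.finrank ℝ (LinearMap.ker (ell A x.1))
      = Module.finrank ℝ (EuclideanSpace ℝ (Fin (2 * n + 1))) := by
  have h0 : ell A x.1 ≠ 0 := by
    intro h
    have := ell_self x
    rw [h] at this
    exact NeZero.ne μ₀ this.symm
  have := Module.Dual.finrank_ker_add_one_of_ne_zero h0
  rw [Module.finrank_fintype_fun_eq_card] at this
  simp only [Fintype.card_sum, Fintype.card_fin] at this
  rw [finrank_euclideanSpace_fin]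
  omega

/-- A linear isomorphism of the hyperplane `(Ax)^⊥` with `ℝ^{2n+1}`. -/
def kerEquiv [NeZero μ₀] (x : Quadric A μ₀) :
    LinearMap.ker (ell A x.1) ≃L[ℝ] EuclideanSpace ℝ (Fin (2 * n + 1)) :=
  ContinuousLinearEquiv.ofFinrankEq (finrank_ker_ell x)

/-- The projection onto the hyperplane `(Ax)^⊥` along `x`. -/
def kerProj [NeZero μ₀] (x : Quadric A μ₀) : Phase n →ₗ[ℝ] LinearMap.ker (ell A x.1) :=
  LinearMap.codRestrict _ (LinearMap.id - (μ₀⁻¹ • ell A x.1).smulRight x.1) (by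
    intro v
    have h := ell_self x
    have h0 := NeZero.ne μ₀
    simp only [LinearMap.mem_ker, LinearMap.sub_apply, LinearMap.id_apply,
      LinearMap.smulRight_apply, LinearMap.smul_apply, map_sub, map_smul, smul_eq_mul, h]
    field_simp
    ring)

lemma kerProj_coe [NeZero μ₀] (x : Quadric A μ₀) (v : Phase n) :
    (kerProj x v : Phase n) = v - (μ₀⁻¹ * ell A x.1 v) • x.1 := rfl

/-- The inverse graph parametrization `u ↦ w + √(1 - H(w) / μ₀) x`, with values in `ℝ^{2n+2}`. -/
def graphMap [NeZero μ₀] (x : Quadric A μ₀) (u : EuclideanSpace ℝ (Fin (2 * n + 1))) : Phase n :=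
  ((kerEquiv x).symm u : Phase n)
    + √(1 - μ₀⁻¹ * ham A ((kerEquiv x).symm u : Phase n)) • x.1

lemma ham_graphMap [NeZero μ₀] (x : Quadric A μ₀) (u : EuclideanSpace ℝ (Fin (2 * n + 1)))
    (hu : 0 ≤ 1 - μ₀⁻¹ * ham A ((kerEquiv x).symm u : Phase n)) :
    ham A (graphMap x u) = μ₀ := by
  have hk : ell A x.1 ((kerEquiv x).symm u : Phase n) = 0 := ((kerEquiv x).symm u).2
  have h0 := NeZero.ne μ₀
  rw [graphMap, ham_add_smul, hk, Real.sq_sqrt hu, x.2]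
  field_simp
  ring

lemma ell_graphMap [NeZero μ₀] (x : Quadric A μ₀) (u : EuclideanSpace ℝ (Fin (2 * n + 1))) :
    μ₀⁻¹ * ell A x.1 (graphMap x u)
      = √(1 - μ₀⁻¹ * ham A ((kerEquiv x).symm u : Phase n)) := by
  have hk : ell A x.1 ((kerEquiv x).symm u : Phase n) = 0 := ((kerEquiv x).symm u).2
  have h0 := NeZero.ne μ₀
  rw [graphMap, map_add, hk, map_smul, ell_self, smul_eq_mul]
  field_simp
  ring

lemma kerEquiv_kerProj_graphMap [NeZero μ₀] (x : Quadric A μ₀)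
    (u : EuclideanSpace ℝ (Fin (2 * n + 1))) : kerEquiv x (kerProj x (graphMap x u)) = u := by
  rw [← (kerEquiv x).eq_symm_apply]
  apply Subtype.ext
  rw [kerProj_coe, ell_graphMap, graphMap]
  simp

lemma one_sub_ham_kerProj [NeZero μ₀] (x y : Quadric A μ₀) :
    1 - μ₀⁻¹ * ham A (kerProj x y.1 : Phase n) = (μ₀⁻¹ * ell A x.1 y.1) ^ 2 := by
  have h0 := NeZero.ne μ₀
  rw [kerProj_coe, sub_eq_add_neg y.1, ← neg_smul, ham_add_smul, x.2, y.2]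
  field_simp
  ring

lemma continuous_ell (x : Phase n) : Continuous (ell A x) :=
  LinearMap.continuous_of_finiteDimensional _

lemma contDiff_omega {E : Type*} [NormedAddCommGroup E] [NormedSpace ℝ E] {f g : E → Phase n}
    {k : WithTop ℕ∞} (hf : ContDiff ℝ k f) (hg : ContDiff ℝ k g) :
    ContDiff ℝ k (fun u => omega (f u) (g u)) := by
  simp only [omega_apply]
  rw [contDiff_pi] at hf hg
  exact ContDiff.sum fun i _ => ((hf _).mul (hg _)).sub ((hf _).mul (hg _))

lemma contDiff_ham {k : WithTop ℕ∞} : ContDiff ℝ k (ham A) :=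
  contDiff_omega contDiff_id
    (LinearMap.toContinuousLinearMap (Matrix.toLin' A.1)).contDiff

lemma contDiff_radicand [NeZero μ₀] (x : Quadric A μ₀) {k : WithTop ℕ∞} :
    ContDiff ℝ k (fun u => 1 - μ₀⁻¹ * ham A ((kerEquiv x).symm u : Phase n)) :=
  contDiff_const.sub (contDiff_const.mul (contDiff_ham.comp
    ((Submodule.subtypeL _).contDiff.comp (kerEquiv x).symm.contDiff)))

/-- The domain of the inverse chart. -/
def graphDomain [NeZero μ₀] (x : Quadric A μ₀) : Set (EuclideanSpace ℝ (Fin (2 * n + 1))) :=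
  {u | 0 < 1 - μ₀⁻¹ * ham A ((kerEquiv x).symm u : Phase n)}

lemma contDiffOn_graphMap [NeZero μ₀] (x : Quadric A μ₀) {k : WithTop ℕ∞} :
    ContDiffOn ℝ k (graphMap x) (graphDomain x) := by
  refine ContDiffOn.add ((Submodule.subtypeL _).contDiff.comp
    (kerEquiv x).symm.contDiff).contDiffOn (ContDiffOn.smul
      (f := fun u => √(1 - μ₀⁻¹ * ham A ((kerEquiv x).symm u : Phase n)))
      (g := fun _ => x.1) ?_ contDiffOn_const)
  exact (contDiff_radicand x).contDiffOn.sqrt fun u hu => ne_of_gt hu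

open Classical in
/-- The chart of the quadric at `x`. -/
def quadricChart [NeZero μ₀] (x : Quadric A μ₀) :
    OpenPartialHomeomorph (Quadric A μ₀) (EuclideanSpace ℝ (Fin (2 * n + 1))) where
  toFun y := kerEquiv x (kerProj x y.1)
  invFun u := if h : ham A (graphMap x u) = μ₀ then ⟨graphMap x u, h⟩ else x
  source := {y | 0 < μ₀⁻¹ * ell A x.1 y.1}
  target := graphDomain x
  map_source' y hy := by
    change 0 < 1 - μ₀⁻¹ * ham A ((kerEquiv x).symm (kerEquiv x (kerProj x y.1)) : Phase n)
    rw [ContinuousLinearEquiv.symm_apply_apply, one_sub_ham_kerProj]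
    exact pow_pos hy 2
  map_target' u hu := by
    have h := ham_graphMap x u (le_of_lt hu)
    rw [dif_pos h]
    change 0 < μ₀⁻¹ * ell A x.1 (graphMap x u)
    rw [ell_graphMap]
    exact Real.sqrt_pos.2 hu
  left_inv' y hy := by
    have hg : graphMap x (kerEquiv x (kerProj x y.1)) = y.1 := by
      rw [graphMap, ContinuousLinearEquiv.symm_apply_apply, one_sub_ham_kerProj,
        Real.sqrt_sq (le_of_lt hy), kerProj_coe, sub_add_cancel]
    have h : ham A (graphMap x (kerEquiv x (kerProj x y.1))) = μ₀ := by rw [hg, y.2]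
    rw [dif_pos h]
    exact Subtype.ext hg
  right_inv' u hu := by
    rw [dif_pos (ham_graphMap x u (le_of_lt hu))]
    exact kerEquiv_kerProj_graphMap x u
  open_source := isOpen_lt continuous_const
    (continuous_const.mul ((continuous_ell x.1).comp continuous_subtype_val))
  open_target := isOpen_lt continuous_const (contDiff_radicand (k := 0) x).continuous
  continuousOn_toFun := ((kerEquiv x).continuous.comp
    ((LinearMap.continuous_of_finiteDimensional (kerProj x)).comp
      continuous_subtype_val)).continuousOn
  continuousOn_invFun := by
    refine (show Topology.IsInducing (Subtype.val : Quadric A μ₀ → Phase n) from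
      ⟨rfl⟩).continuousOn_iff.2 ?_
    refine (contDiffOn_graphMap (k := 0) x).continuousOn.congr fun u hu => ?_
    simp only [Function.comp_apply]
    rw [dif_pos (ham_graphMap x u (le_of_lt hu))]

lemma quadricChart_symm_coe [NeZero μ₀] (x : Quadric A μ₀)
    {u : EuclideanSpace ℝ (Fin (2 * n + 1))} (hu : u ∈ graphDomain x) :
    ((quadricChart x).symm u : Phase n) = graphMap x u := by
  change (dite _ _ _ : Quadric A μ₀).1 = _
  rw [dif_pos (ham_graphMap x u (le_of_lt hu))]

/-- The quadric is a manifold of dimension `2n+1`. -/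
instance quadricChartedSpace [NeZero μ₀] : ChartedSpace (EuclideanSpace ℝ (Fin (2 * n + 1))) (Quadric A μ₀) where
  atlas := Set.range quadricChart
  chartAt := quadricChart
  mem_chart_source x := by
    change 0 < μ₀⁻¹ * ell A x.1 x.1
    rw [ell_self, inv_mul_cancel₀ (NeZero.ne μ₀)]
    exact one_pos
  chart_mem_atlas x := ⟨x, rfl⟩

instance quadricIsManifold [NeZero μ₀] : IsManifold (𝓡 (2 * n + 1)) ∞ (Quadric A μ₀) := by
  refine isManifold_of_contDiffOn _ _ _ ?_
  rintro _ _ ⟨x, rfl⟩ ⟨y, rfl⟩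
  have h : ContDiffOn ℝ ∞ (fun u => kerEquiv y (kerProj y (graphMap x u))) (graphDomain x) :=
    ((kerEquiv y).contDiff.comp
      (LinearMap.toContinuousLinearMap (kerProj y)).contDiff).comp_contDiffOn
      (contDiffOn_graphMap x)
  have hs : (𝓡 (2 * n + 1)).symm ⁻¹' ((quadricChart x).symm ≫ₕ quadricChart y).source
      ∩ Set.range (𝓡 (2 * n + 1)) ⊆ graphDomain x := fun u hu => hu.1.1
  refine (h.mono hs).congr fun u hu => ?_
  change kerEquiv y (kerProj y ((quadricChart x).symm u).1) = _
  rw [quadricChart_symm_coe x (hs hu)]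

/-- The inclusion of the quadric into `ℝ^{2n+2}` is smooth. -/
lemma contMDiff_coe [NeZero μ₀] :
    ContMDiff (𝓡 (2 * n + 1)) 𝓘(ℝ, Phase n) ∞ (Subtype.val : Quadric A μ₀ → Phase n) := by
  rw [contMDiff_iff]
  refine ⟨continuous_subtype_val, fun x _ => ?_⟩
  have hs : (extChartAt (𝓡 (2 * n + 1)) x).target ⊆ graphDomain x := by
    intro u hu
    rw [extChartAt_target] at hu
    exact hu.1
  refine ((contDiffOn_graphMap x).mono (fun u hu => hs hu.1)).congr fun u hu => ?_
  exact quadricChart_symm_coe x (hs hu.1)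

end Charts

/-! ### Horizontal lifts -/

section Lift

variable (A : Sp n) (μ₀ : ℝ) [NeZero μ₀]

/-- The differential `T_xΣ → ℝ^{2n+2}` of the inclusion, which identifies a tangent vector of the
quadric with a vector of the ambient space. -/
def incl (x : Quadric A μ₀) : TangentSpace (𝓡 (2 * n + 1)) x →L[ℝ] Phase n :=
  mvfderiv (𝓡 (2 * n + 1)) (Subtype.val : Quadric A μ₀ → Phase n) x

/-- The horizontal space `H_x = span(x, Ax)^⊥`, as a subspace of `T_xΣ`. -/
def horizontal (x : Quadric A μ₀) : Submodule ℝ (TangentSpace (𝓡 (2 * n + 1)) x) where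
  carrier := {u | omega (incl A μ₀ x u) x.1 = 0 ∧ omega (incl A μ₀ x u) (A.1 *ᵥ x.1) = 0}
  zero_mem' := by simp
  add_mem' := by
    rintro u v ⟨h1, h2⟩ ⟨h3, h4⟩
    simp [h1, h2, h3, h4]
  smul_mem' := by
    rintro c u ⟨h1, h2⟩
    simp [h1, h2]

/-- The connection of the quadric, `∇_u Z = D_u Z + (1 / μ₀) ω(Z, Au) x`, where `D` is the flat
connection of `ℝ^{2n+2}`; its values are written as vectors of `ℝ^{2n+2}`. -/
def quadricConnection (Z : (x : Quadric A μ₀) → TangentSpace (𝓡 (2 * n + 1)) x)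
    (x : Quadric A μ₀) (u : TangentSpace (𝓡 (2 * n + 1)) x) : Phase n :=
  mvfderiv (𝓡 (2 * n + 1)) (fun p : Quadric A μ₀ => incl A μ₀ p (Z p)) x u
    + (1 / μ₀ * omega (incl A μ₀ x (Z x)) (A.1 *ᵥ incl A μ₀ x u)) • x.1

variable [ChartedSpace (EuclideanSpace ℝ (Fin (2 * n))) (Reduced A μ₀)]

/-- The differential `π_{*x} : T_xΣ → T_{π(x)}M` of the projection. -/
def dproj (x : Quadric A μ₀) :
    TangentSpace (𝓡 (2 * n + 1)) x →L[ℝ] TangentSpace (𝓡 (2 * n)) (proj A μ₀ x) :=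
  mfderiv (𝓡 (2 * n + 1)) (𝓡 (2 * n)) (proj A μ₀) x

/-- The horizontal lift at `x`, that is the inverse of `π_{*x} : H_x → T_{π(x)}M`. -/
def lift (x : Quadric A μ₀) :
    TangentSpace (𝓡 (2 * n)) (proj A μ₀ x) →L[ℝ] TangentSpace (𝓡 (2 * n + 1)) x :=
  (horizontal A μ₀ x).subtypeL ∘L
    ((dproj A μ₀ x) ∘L (horizontal A μ₀ x).subtypeL).inverse

/-- The horizontal lift at `x`, as a vector of `ℝ^{2n+2}`. -/
def hlift (x : Quadric A μ₀) : TangentSpace (𝓡 (2 * n)) (proj A μ₀ x) →L[ℝ] Phase n :=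
  incl A μ₀ x ∘L lift A μ₀ x

/-- The horizontal lift `Z̄` of a vector field `Z` on `M`, a vector field on the quadric. -/
def liftField (Z : (y : Reduced A μ₀) → TangentSpace (𝓡 (2 * n)) y) (x : Quadric A μ₀) :
    TangentSpace (𝓡 (2 * n + 1)) x :=
  lift A μ₀ x (Z (proj A μ₀ x))

end Lift

/-! ### Symplectic connections and curvature of Ricci type -/

section RicciType

variable {W : Type*} [AddCommGroup W] [Module ℝ W]

/-- The Ricci tensor `r(X, Y) = tr (Z ↦ R(X, Z)Y)` of `R : (X, Y, Z) ↦ R(X, Y)Z`. -/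
def ricciTensor (R : W →ₗ[ℝ] W →ₗ[ℝ] W →ₗ[ℝ] W) (X Y : W) : ℝ :=
  LinearMap.trace ℝ W ((R X).flip Y)

/-- The component `E` of a symplectic curvature tensor on a symplectic vector space `(W, Ω)`, the
one determined by the Ricci tensor, as a covariant tensor. If `dim W = 2n`, the constant is
`-1 / (2(n+1))`. -/
def ricciPart (Ω : W →ₗ[ℝ] W →ₗ[ℝ] ℝ) (R : W →ₗ[ℝ] W →ₗ[ℝ] W →ₗ[ℝ] W) (X Y Z T : W) : ℝ :=
  -1 / (Module.finrank ℝ W + 2) *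
    (2 * Ω X Y * ricciTensor R Z T + Ω X Z * ricciTensor R Y T + Ω X T * ricciTensor R Y Z
      - Ω Y Z * ricciTensor R X T - Ω Y T * ricciTensor R X Z)

/-- The component `W = R - E` of a symplectic curvature tensor, as a covariant tensor. -/
def weylPart (Ω : W →ₗ[ℝ] W →ₗ[ℝ] ℝ) (R : W →ₗ[ℝ] W →ₗ[ℝ] W →ₗ[ℝ] W) (X Y Z T : W) : ℝ :=
  Ω (R X Y Z) T - ricciPart Ω R X Y Z T

/-- A symplectic curvature tensor is of Ricci type if its `W` component vanishes. -/
def IsRicciType (Ω : W →ₗ[ℝ] W →ₗ[ℝ] ℝ) (R : W →ₗ[ℝ] W →ₗ[ℝ] W →ₗ[ℝ] W) : Prop :=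
  ∀ X Y Z T : W, weylPart Ω R X Y Z T = 0

end RicciType

section Connections

variable {d : ℕ} {M : Type*} [TopologicalSpace M] [ChartedSpace (EuclideanSpace ℝ (Fin d)) M]

variable (d M) in
/-- Vector fields on the `d`-dimensional manifold `M`. -/
abbrev VField : Type _ := (y : M) → TangentSpace (𝓡 d) y

variable (d M) in
/-- Fields of bilinear forms on the tangent spaces of `M`. -/
abbrev BilinField : Type _ :=
  (y : M) → TangentSpace (𝓡 d) y →ₗ[ℝ] TangentSpace (𝓡 d) y →ₗ[ℝ] ℝ

variable (d M) in
/-- Fields of endomorphisms of the tangent spaces of `M`. -/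
abbrev EndField : Type _ := (y : M) → TangentSpace (𝓡 d) y →ₗ[ℝ] TangentSpace (𝓡 d) y

variable (d M) in
/-- Fields of trilinear maps `(X, Y, Z) ↦ R(X, Y)Z` on the tangent spaces of `M`. -/
abbrev CurvField : Type _ :=
  (y : M) → TangentSpace (𝓡 d) y →ₗ[ℝ] TangentSpace (𝓡 d) y →ₗ[ℝ]
    TangentSpace (𝓡 d) y →ₗ[ℝ] TangentSpace (𝓡 d) y

/-- The derivative `u f` of a function `f` in the direction of a tangent vector `u` at `y`. -/
def dirDeriv (f : M → ℝ) (y : M) (u : TangentSpace (𝓡 d) y) : ℝ :=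
  mvfderiv (𝓡 d) f y u

variable [IsManifold (𝓡 d) 1 M]

/-- The vector field `X` is smooth at `y`. -/
def SmoothAt (X : VField d M) (y : M) : Prop :=
  ContMDiffAt (𝓡 d) (𝓡 d).tangent ∞ (fun p => (⟨p, X p⟩ : TangentBundle (𝓡 d) M)) y

/-- The vector field `X` is differentiable at `y`. -/
def DiffAt (X : VField d M) (y : M) : Prop :=
  MDifferentiableAt (𝓡 d) (𝓡 d).tangent (fun p => (⟨p, X p⟩ : TangentBundle (𝓡 d) M)) y

/-- The Lie bracket of vector fields. -/
abbrev bracket (X Y : VField d M) : VField d M := VectorField.mlieBracket (𝓡 d) X Y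

variable (d M) in
/-- Linear connections on `M`. -/
abbrev Connection : Type _ :=
  CovariantDerivative (𝓡 d) (EuclideanSpace ℝ (Fin d)) (TangentSpace (𝓡 d) : M → Type _)

/-- The vector field `∇_X Y`. -/
def Connection.nabla (D : Connection d M) (X Y : VField d M) : VField d M :=
  fun y => D Y y (X y)

/-- `Ω` is a symplectic form: a smooth, closed and nondegenerate 2-form. -/
structure IsSymplecticForm (Ω : BilinField d M) : Prop where
  alternating : ∀ (y : M) (u : TangentSpace (𝓡 d) y), Ω y u u = 0
  nondegenerate : ∀ (y : M) (u : TangentSpace (𝓡 d) y), (∀ v, Ω y u v = 0) → u = 0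
  smooth : ∀ (y : M) (X Y : VField d M), SmoothAt X y → SmoothAt Y y →
    ContMDiffAt (𝓡 d) 𝓘(ℝ, ℝ) ∞ (fun p => Ω p (X p) (Y p)) y
  closed : ∀ (y : M) (X Y Z : VField d M), SmoothAt X y → SmoothAt Y y → SmoothAt Z y →
    dirDeriv (fun p => Ω p (Y p) (Z p)) y (X y)
      + dirDeriv (fun p => Ω p (Z p) (X p)) y (Y y)
      + dirDeriv (fun p => Ω p (X p) (Y p)) y (Z y)
      - Ω y (bracket X Y y) (Z y) - Ω y (bracket Y Z y) (X y) - Ω y (bracket Z X y) (Y y) = 0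

/-- `D` is a symplectic connection on `(M, Ω)`: a smooth, torsion free linear connection for which
`Ω` is parallel. -/
structure IsSymplecticConnection (Ω : BilinField d M) (D : Connection d M) : Prop where
  smooth : ∀ (y : M) (X Y : VField d M), SmoothAt X y → SmoothAt Y y → SmoothAt (D.nabla X Y) y
  torsion_free : ∀ (y : M) (X Y : VField d M), SmoothAt X y → SmoothAt Y y →
    D.nabla X Y y - D.nabla Y X y = bracket X Y y
  parallel : ∀ (y : M) (X Y Z : VField d M), SmoothAt X y → SmoothAt Y y → SmoothAt Z y →
    dirDeriv (fun p => Ω p (Y p) (Z p)) y (X y)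
      = Ω y (D.nabla X Y y) (Z y) + Ω y (Y y) (D.nabla X Z y)

/-- `R` is the curvature tensor of `D`: `R(X, Y)Z = ∇_X ∇_Y Z - ∇_Y ∇_X Z - ∇_{[X, Y]} Z` for all
smooth vector fields (which may be given near a point only). -/
def IsCurvatureTensor (D : Connection d M) (R : CurvField d M) : Prop :=
  ∀ (y : M) (X Y Z : VField d M), SmoothAt X y → SmoothAt Y y → SmoothAt Z y →
    R y (X y) (Y y) (Z y)
      = D.nabla X (D.nabla Y Z) y - D.nabla Y (D.nabla X Z) y - D.nabla (bracket X Y) Z y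

end Connections

/-! ### The form, the endomorphisms and the connection of the reduced space -/

section ReducedObjects

variable (A : Sp n) (μ₀ : ℝ) [NeZero μ₀]
  [ChartedSpace (EuclideanSpace ℝ (Fin (2 * n))) (Reduced A μ₀)]

/-- `Ω` is the reduced form: `Ω_{π(x)}(Y, Z) = ω(Ȳ, Z̄)` at every point `x` of the quadric. -/
def IsReducedForm (Ω : BilinField (2 * n) (Reduced A μ₀)) : Prop :=
  ∀ (x : Quadric A μ₀) (u v : TangentSpace (𝓡 (2 * n)) (proj A μ₀ x)),
    Ω (proj A μ₀ x) u v = omega (hlift A μ₀ x u) (hlift A μ₀ x v)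

/-- `B` is the field of endomorphisms `A_y` induced by `A`: at every point `x` of the quadric, the
horizontal lift of `A_{π(x)} U` is `AŪ - (1 / μ₀) ω(AŪ, Ax) x`. -/
def IsInducedEnd (B : EndField (2 * n) (Reduced A μ₀)) : Prop :=
  ∀ (x : Quadric A μ₀) (u : TangentSpace (𝓡 (2 * n)) (proj A μ₀ x)),
    hlift A μ₀ x (B (proj A μ₀ x) u)
      = A.1 *ᵥ hlift A μ₀ x u
        - (1 / μ₀ * omega (A.1 *ᵥ hlift A μ₀ x u) (A.1 *ᵥ x.1)) • x.1

/-- `D` is the reduced connection: at every point `x` of the quadric, the horizontal lift of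
`∇^r_Y Z` is `∇_Ȳ Z̄ + (1 / μ₀) ω(Ȳ, Z̄) Ax`. A connection being determined on differentiable vector
fields by its values on smooth ones, the equation is written for all `Z` for which it has a
meaning. -/
def IsReducedConnection [IsManifold (𝓡 (2 * n)) 1 (Reduced A μ₀)]
    (D : Connection (2 * n) (Reduced A μ₀)) : Prop :=
  ∀ (x : Quadric A μ₀) (Z : VField (2 * n) (Reduced A μ₀)), DiffAt Z (proj A μ₀ x) →
    ∀ u : TangentSpace (𝓡 (2 * n)) (proj A μ₀ x),
      hlift A μ₀ x (D Z (proj A μ₀ x) u)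
        = quadricConnection A μ₀ (liftField A μ₀ Z) x (lift A μ₀ x u)
          + (1 / μ₀ * omega (hlift A μ₀ x u) (hlift A μ₀ x (Z (proj A μ₀ x)))) • (A.1 *ᵥ x.1)

end ReducedObjects

end SymplecticReduction

end

/-! Everything is carried to `M` by a local section `s` of `π`, read as a map `σ : M → ℝ^{2n+2}`
with values in the quadric. The kernel of `π_*` at `x` is the line through `Ax`, and `ω(Ax, x) = -μ₀
≠ 0`. Hence the horizontal lift of `v` is `dσ(v) + c(v) Aσ` with `c(v) = ω(dσ(v), σ) / μ₀`; this is
`horDeriv` (see `hlift_eq_horDeriv`). Lifted fields are invariant under the flow, so their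
derivative in the direction `Ax` is multiplication by `A`. Differentiating a lifted field along a
lifted vector therefore becomes, on `M`, the connection `d + c ⊗ A` on the trivial bundle with fibre
`ℝ^{2n+2}`. This is `twistDeriv`, and `∇^r` adds to it the multiples of `σ` and `Aσ` that make the
result horizontal (`quadricConnection_eq_connLift`).

Three facts about `twistDeriv` carry the computation. It satisfies the product rule for `ω`, because
`A` is in the symplectic algebra. Applied to `σ` along `X` it gives the lift of `X`. Its curvature
is `dc ⊗ A = -(2/μ₀) Ω ⊗ A` (`twistDeriv_comm`).

Since `σ` maps to a level set of `H`, the form `Ω` is the pull-back of `ω` by `σ`, hence closed.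
Parallelism of `Ω` is the product rule. Vanishing torsion is the curvature identity applied to `σ`,
and the curvature of `∇^r` is the same identity applied to a lifted field, plus the terms produced
when the corrections along `σ` and `Aσ` are differentiated again. Multiples of `σ` and `Aσ`
themselves can be dropped, because they are transverse to the horizontal space
(`IsLocalModel.eq_of_horDeriv`).

That the resulting tensor is of Ricci type is linear algebra: its Ricci tensor is a multiple of
`Ω(·, B·)`, so substituting it back recovers the tensor (`isRicciType_endoCurvature`).

The reduced objects exist because two sections through the same fibre differ at that point by some
`ψ_t`, which is linear, preserves `ω` and commutes with `A` (`exists_section_flow`). -/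

noncomputable section

namespace SymplecticReduction

variable {n : ℕ}

/-! ### Calculus of vector fields on a manifold -/

section Calculus

open Filter Topology

variable {d : ℕ} {M : Type*} [TopologicalSpace M] [ChartedSpace (EuclideanSpace ℝ (Fin d)) M]
  {F G : Type*} [NormedAddCommGroup F] [NormedSpace ℝ F] [NormedAddCommGroup G] [NormedSpace ℝ G]

/-- The derivative `X f` of a vector valued function along a vector field. -/
def fieldDeriv (X : VField d M) (f : M → F) (p : M) : F := mvfderiv (𝓡 d) f p (X p)

lemma mvfderiv_comp_mfderiv {k : ℕ} {N : Type*} [TopologicalSpace N]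
    [ChartedSpace (EuclideanSpace ℝ (Fin k)) N] {g : M → F} {f : N → M} {x : N} {y : M}
    (hy : f x = y)
    (hg : MDifferentiableAt (𝓡 d) 𝓘(ℝ, F) g y) (hf : MDifferentiableAt (𝓡 k) (𝓡 d) f x)
    (v : TangentSpace (𝓡 k) x) :
    mvfderiv (𝓡 k) (g ∘ f) x v = mvfderiv (𝓡 d) g y (mfderiv (𝓡 k) (𝓡 d) f x v) := by
  subst hy
  exact mfderiv_comp_apply x hg hf v

lemma mvfderiv_fderiv_comp {f : M → F} {g : F → G} {p : M}
    (hg : DifferentiableAt ℝ g (f p)) (hf : MDifferentiableAt (𝓡 d) 𝓘(ℝ, F) f p)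
    (v : TangentSpace (𝓡 d) p) :
    mvfderiv (𝓡 d) (fun q => g (f q)) p v = fderiv ℝ g (f p) (mvfderiv (𝓡 d) f p v) := by
  have := mfderiv_comp_apply p hg.mdifferentiableAt hf v
  rw [mfderiv_eq_fderiv] at this
  exact this

lemma mvfderiv_congr {f g : M → F} {p : M} (h : f =ᶠ[𝓝 p] g) :
    mvfderiv (𝓡 d) f p = mvfderiv (𝓡 d) g p := by
  unfold mvfderiv
  rw [h.mfderiv_eq, h.eq_of_nhds]

lemma fieldDeriv_congr {f g : M → F} {p : M} (X : VField d M) (h : f =ᶠ[𝓝 p] g) :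
    fieldDeriv X f p = fieldDeriv X g p := by
  rw [fieldDeriv, mvfderiv_congr h, fieldDeriv]

lemma mvfderiv_clm (L : F →L[ℝ] G) {f : M → F} {p : M} (hf : MDifferentiableAt (𝓡 d) 𝓘(ℝ, F) f p)
    (v : TangentSpace (𝓡 d) p) :
    mvfderiv (𝓡 d) (fun q => L (f q)) p v = L (mvfderiv (𝓡 d) f p v) := by
  rw [mvfderiv_fderiv_comp L.differentiableAt hf, L.fderiv]

variable [IsManifold (𝓡 d) ∞ M]

/-- The trivialization at `y` is the differential of the chart at `y`, so the coordinates of `X` are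
the derivatives of the chart along `X`. -/
lemma smoothAt_iff_chart {X : VField d M} {y : M} :
    SmoothAt X y ↔
      ContMDiffAt (𝓡 d) 𝓘(ℝ, EuclideanSpace ℝ (Fin d)) ∞
        (fieldDeriv X (extChartAt (𝓡 d) y)) y := by
  refine (Bundle.contMDiffAt_section _).trans ?_
  refine Filter.EventuallyEq.contMDiffAt_iff ?_
  filter_upwards [(chartAt (EuclideanSpace ℝ (Fin d)) y).open_source.mem_nhds
    (mem_chart_source _ y)] with p hp
  have := TangentBundle.continuousLinearMapAt_trivializationAt (I := 𝓡 d) hp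
  have h2 := congrArg (fun L => L (X p)) this
  refine Eq.trans ?_ h2
  rw [Bundle.Trivialization.continuousLinearMapAt_apply,
     Bundle.Trivialization.linearMapAt_apply, if_pos (by simpa using hp)]

lemma diffAt_iff_chart {X : VField d M} {y : M} :
    DiffAt X y ↔
      MDifferentiableAt (𝓡 d) 𝓘(ℝ, EuclideanSpace ℝ (Fin d))
        (fieldDeriv X (extChartAt (𝓡 d) y)) y := by
  refine (mdifferentiableAt_section _ _).trans ?_
  refine Filter.EventuallyEq.mdifferentiableAt_iff ?_
  filter_upwards [(chartAt (EuclideanSpace ℝ (Fin d)) y).open_source.mem_nhds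
    (mem_chart_source _ y)] with p hp
  have := TangentBundle.continuousLinearMapAt_trivializationAt (I := 𝓡 d) hp
  have h2 := congrArg (fun L => L (X p)) this
  refine Eq.trans ?_ h2
  rw [Bundle.Trivialization.continuousLinearMapAt_apply,
     Bundle.Trivialization.linearMapAt_apply, if_pos (by simpa using hp)]

/-- A function read in the chart at `y`. -/
abbrev chartFun (y : M) (f : M → F) : EuclideanSpace ℝ (Fin d) → F :=
  fun u => f ((extChartAt (𝓡 d) y).symm u)

omit [NormedAddCommGroup F] [NormedSpace ℝ F] [IsManifold (𝓡 d) ∞ M] in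
lemma chartFun_eventuallyEq (y : M) (f : M → F) {p : M}
    (hp : p ∈ (chartAt (EuclideanSpace ℝ (Fin d)) y).source) :
    (fun q => chartFun y f (extChartAt (𝓡 d) y q)) =ᶠ[𝓝 p] f := by
  filter_upwards [(chartAt (EuclideanSpace ℝ (Fin d)) y).open_source.mem_nhds hp] with q hq
  have h : q ∈ (extChartAt (𝓡 d) y).source := by rwa [extChartAt_source]
  exact congrArg f ((extChartAt (𝓡 d) y).left_inv h)

omit [IsManifold (𝓡 d) ∞ M] in
lemma isOpen_extChartAt_target_euclidean (y : M) : IsOpen (extChartAt (𝓡 d) y).target :=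
  isOpen_extChartAt_target y

lemma mdifferentiableAt_extChartAt_symm {y : M} {u : EuclideanSpace ℝ (Fin d)}
    (hu : u ∈ (extChartAt (𝓡 d) y).target) :
    MDifferentiableAt 𝓘(ℝ, EuclideanSpace ℝ (Fin d)) (𝓡 d) (extChartAt (𝓡 d) y).symm u :=
  ((contMDiffOn_extChartAt_symm (n := ∞) y).contMDiffAt
    ((isOpen_extChartAt_target_euclidean y).mem_nhds hu)).mdifferentiableAt (by simp)

lemma contDiffAt_chartFun {f : M → F} {y : M} {k : ℕ∞}
    (hf : ContMDiffAt (𝓡 d) 𝓘(ℝ, F) k f y) :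
    ContDiffAt ℝ k (chartFun y f) (extChartAt (𝓡 d) y y) := by
  rw [← contMDiffAt_iff_contDiffAt]
  refine ContMDiffAt.comp (I' := 𝓡 d) _ ?_ (((contMDiffOn_extChartAt_symm (n := ∞) y).contMDiffAt
    ((isOpen_extChartAt_target_euclidean y).mem_nhds (mem_extChartAt_target y))).of_le
      (mod_cast le_top))
  rwa [extChartAt_to_inv]

lemma differentiableAt_chartFun {f : M → F} {y p : M}
    (hp : p ∈ (chartAt (EuclideanSpace ℝ (Fin d)) y).source)
    (hf : MDifferentiableAt (𝓡 d) 𝓘(ℝ, F) f p) :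
    DifferentiableAt ℝ (chartFun y f) (extChartAt (𝓡 d) y p) := by
  have h : p ∈ (extChartAt (𝓡 d) y).source := by rwa [extChartAt_source]
  rw [← mdifferentiableAt_iff_differentiableAt]
  refine MDifferentiableAt.comp (I' := 𝓡 d) _ ?_ (mdifferentiableAt_extChartAt_symm
    ((extChartAt (𝓡 d) y).map_source h))
  rwa [(extChartAt (𝓡 d) y).left_inv h]

lemma mvfderiv_eq_chartFun {f : M → F} {y p : M}
    (hp : p ∈ (chartAt (EuclideanSpace ℝ (Fin d)) y).source)
    (hf : MDifferentiableAt (𝓡 d) 𝓘(ℝ, F) f p) (v : TangentSpace (𝓡 d) p) :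
    mvfderiv (𝓡 d) f p v = fderiv ℝ (chartFun y f) (extChartAt (𝓡 d) y p)
      (mvfderiv (𝓡 d) (extChartAt (𝓡 d) y) p v) := by
  rw [← mvfderiv_congr (chartFun_eventuallyEq y f hp)]
  exact mvfderiv_fderiv_comp (differentiableAt_chartFun hp hf) (mdifferentiableAt_extChartAt hp) v

omit [IsManifold (𝓡 d) ∞ M] in
lemma eventually_mem_chart_source (y : M) :
    ∀ᶠ p in 𝓝 y, p ∈ (chartAt (EuclideanSpace ℝ (Fin d)) y).source :=
  (chartAt (EuclideanSpace ℝ (Fin d)) y).open_source.mem_nhds (mem_chart_source _ y)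

lemma eventually_contMDiffAt {f : M → F} {y : M} {k : ℕ}
    (hf : ContMDiffAt (𝓡 d) 𝓘(ℝ, F) ∞ f y) :
    ∀ᶠ p in 𝓝 y, ContMDiffAt (𝓡 d) 𝓘(ℝ, F) k f p :=
  haveI : IsManifold (𝓡 d) (k : ℕ∞) M := IsManifold.of_le (n := ∞) (mod_cast le_top)
  (contMDiffAt_iff_contMDiffAt_nhds (by simp)).1 (hf.of_le (mod_cast le_top))

lemma eventually_mdifferentiableAt {f : M → F} {y : M}
    (hf : ContMDiffAt (𝓡 d) 𝓘(ℝ, F) ∞ f y) :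
    ∀ᶠ p in 𝓝 y, MDifferentiableAt (𝓡 d) 𝓘(ℝ, F) f p :=
  (eventually_contMDiffAt (d := d) (k := 1) hf).mono fun _ h =>
    ContMDiffAt.mdifferentiableAt h (by simp)

lemma fieldDeriv_eventuallyEq {f : M → F} {y : M} (X : VField d M)
    (hf : ContMDiffAt (𝓡 d) 𝓘(ℝ, F) ∞ f y) :
    fieldDeriv X f =ᶠ[𝓝 y] fun p => fderiv ℝ (chartFun y f) (extChartAt (𝓡 d) y p)
      (fieldDeriv X (extChartAt (𝓡 d) y) p) := by
  filter_upwards [eventually_mem_chart_source (d := d) y, eventually_mdifferentiableAt hf]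
    with p hp h using
    mvfderiv_eq_chartFun hp h (X p)

lemma contDiffAt_fderiv_chartFun {f : M → F} {y : M} (hf : ContMDiffAt (𝓡 d) 𝓘(ℝ, F) ∞ f y) :
    ContDiffAt ℝ ∞ (fderiv ℝ (chartFun y f)) (extChartAt (𝓡 d) y y) :=
  (contDiffAt_chartFun (k := ⊤) hf).fderiv_right (by simp)

lemma contMDiffAt_fieldDeriv {f : M → F} {y : M} {X : VField d M}
    (hf : ContMDiffAt (𝓡 d) 𝓘(ℝ, F) ∞ f y) (hX : SmoothAt X y) :
    ContMDiffAt (𝓡 d) 𝓘(ℝ, F) ∞ (fieldDeriv X f) y := by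
  refine ContMDiffAt.congr_of_eventuallyEq ?_ (fieldDeriv_eventuallyEq X hf)
  refine ContMDiffAt.clm_apply ?_ (smoothAt_iff_chart.1 hX)
  exact (contDiffAt_fderiv_chartFun hf).contMDiffAt.comp y contMDiffAt_extChartAt

lemma mdifferentiableAt_fieldDeriv {f : M → F} {y : M} {X : VField d M}
    (hf : ContMDiffAt (𝓡 d) 𝓘(ℝ, F) ∞ f y) (hX : DiffAt X y) :
    MDifferentiableAt (𝓡 d) 𝓘(ℝ, F) (fieldDeriv X f) y := by
  refine MDifferentiableAt.congr_of_eventuallyEq ?_ (fieldDeriv_eventuallyEq X hf)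
  refine MDifferentiableAt.clm_apply ?_ (diffAt_iff_chart.1 hX)
  exact ((contDiffAt_fderiv_chartFun hf).contMDiffAt.comp y
    contMDiffAt_extChartAt).mdifferentiableAt (by simp)

lemma SmoothAt.diffAt {X : VField d M} {y : M} (hX : SmoothAt X y) : DiffAt X y :=
  ContMDiffAt.mdifferentiableAt hX (by simp)

lemma SmoothAt.eventually_diffAt {X : VField d M} {y : M} (hX : SmoothAt X y) :
    ∀ᶠ p in 𝓝 y, DiffAt X p := by
  have h : ∀ᶠ p in 𝓝 y, ContMDiffAt (𝓡 d) (𝓡 d).tangent 1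
      (fun p => (⟨p, X p⟩ : TangentBundle (𝓡 d) M)) p :=
    (contMDiffAt_iff_contMDiffAt_nhds (by simp)).1 (ContMDiffAt.of_le hX (mod_cast le_top))
  exact h.mono fun p hp => ContMDiffAt.mdifferentiableAt hp (by simp)

/-- In the chart at `y` the second-order part of `XYf - YXf` vanishes by symmetry of the second
derivative, and what remains is the derivative of `f` along the coordinate bracket. -/
lemma fieldDeriv_bracket {f : M → F} {y : M} {X Y : VField d M}
    (hf : ContMDiffAt (𝓡 d) 𝓘(ℝ, F) ∞ f y) (hX : SmoothAt X y) (hY : SmoothAt Y y) :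
    fieldDeriv (bracket X Y) f y
      = fieldDeriv X (fieldDeriv Y f) y - fieldDeriv Y (fieldDeriv X f) y := by
  set φ := extChartAt (𝓡 d) y with hφ
  have hf' := contDiffAt_fderiv_chartFun hf
  have key : ∀ {X Y : VField d M}, SmoothAt X y → SmoothAt Y y →
      fieldDeriv X (fieldDeriv Y f) y
        = fderiv ℝ (fderiv ℝ (chartFun y f)) (φ y) (fieldDeriv X φ y) (fieldDeriv Y φ y)
          + fderiv ℝ (chartFun y f) (φ y)
            (fderiv ℝ (chartFun y (fieldDeriv Y φ)) (φ y) (fieldDeriv X φ y)) := by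
    intro X Y hX hY
    have hY' := smoothAt_iff_chart.1 hY
    rw [fieldDeriv_congr X (fieldDeriv_eventuallyEq Y hf), fieldDeriv,
      mvfderiv_eq_chartFun (mem_chart_source _ y)]
    · have e : chartFun y (fun p => fderiv ℝ (chartFun y f) (φ p) (fieldDeriv Y φ p))
          =ᶠ[𝓝 (φ y)] fun u => fderiv ℝ (chartFun y f) u (chartFun y (fieldDeriv Y φ) u) := by
        filter_upwards [(isOpen_extChartAt_target_euclidean y).mem_nhds
          (mem_extChartAt_target y)] with u hu
        simp only [chartFun]
        rw [φ.right_inv hu]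
      rw [e.fderiv_eq, fderiv_clm_apply (hf'.differentiableAt (by simp))
        ((contDiffAt_chartFun (k := ⊤) hY').differentiableAt (by simp))]
      simp only [add_apply, ContinuousLinearMap.comp_apply,
        ContinuousLinearMap.flip_apply]
      rw [add_comm]
      congr 2
      simp only [chartFun]
      rw [hφ, extChartAt_to_inv]
    · exact MDifferentiableAt.clm_apply ((hf'.contMDiffAt.comp y
        contMDiffAt_extChartAt).mdifferentiableAt (by simp)) (hY'.mdifferentiableAt (by simp))
  -- The manifold bracket is the bracket in the chart, pulled back by the differential of the chart;
  -- at the base point that differential is the identity.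
  have hb : bracket X Y y = VectorField.lieBracket ℝ (chartFun y (fieldDeriv X φ))
      (chartFun y (fieldDeriv Y φ)) (φ y) := by
    have hr : ∀ Z : VField d M, (VectorField.mpullbackWithin 𝓘(ℝ, EuclideanSpace ℝ (Fin d)) (𝓡 d)
        φ.symm Z (Set.range (𝓡 d)) : EuclideanSpace ℝ (Fin d) → EuclideanSpace ℝ (Fin d))
        =ᶠ[𝓝 (φ y)] chartFun y (fieldDeriv Z φ) := by
      intro Z
      filter_upwards [(isOpen_extChartAt_target_euclidean y).mem_nhds
          (mem_extChartAt_target y)] with u hu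
      have h := ContinuousLinearMap.inverse_eq
        (mfderivWithin_extChartAt_symm_comp_mfderiv_extChartAt (I := 𝓡 d) hu)
        (mfderiv_extChartAt_comp_mfderivWithin_extChartAt_symm (I := 𝓡 d) hu)
      exact congrArg (fun L => L (Z (φ.symm u))) h
    set P : VField d M → EuclideanSpace ℝ (Fin d) → EuclideanSpace ℝ (Fin d) := fun Z =>
      VectorField.mpullbackWithin 𝓘(ℝ, EuclideanSpace ℝ (Fin d)) (𝓡 d)
        φ.symm Z (Set.range (𝓡 d))
    have h1 : bracket X Y y = (ContinuousLinearMap.id ℝ (EuclideanSpace ℝ (Fin d))).inverse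
        (VectorField.lieBracketWithin ℝ (P X) (P Y)
          (φ.symm ⁻¹' Set.univ ∩ Set.range (𝓡 d)) (φ y)) :=
      congrArg (fun L : EuclideanSpace ℝ (Fin d) →L[ℝ] EuclideanSpace ℝ (Fin d) =>
        L.inverse (VectorField.lieBracketWithin ℝ (P X) (P Y)
          (φ.symm ⁻¹' Set.univ ∩ Set.range (𝓡 d)) (φ y)))
        (mfderiv_extChartAt_self (I := 𝓡 d) (x := y))
    rw [h1, ContinuousLinearMap.inverse_id, Set.preimage_univ,
      Set.univ_inter, ModelWithCorners.range_eq_univ, VectorField.lieBracketWithin_univ]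
    exact (hr X).lieBracket_vectorField_eq (hr Y)
  have hself : ∀ Z : VField d M, fieldDeriv Z φ y = Z y := by
    intro Z
    have h := mfderiv_extChartAt_self (I := 𝓡 d) (x := y)
    exact congrArg (fun L => L (Z y)) h
  have hc : ∀ Z : VField d M, chartFun y (fieldDeriv Z φ) (φ y) = fieldDeriv Z φ y := by
    intro Z
    simp only [chartFun, hφ]
    rw [extChartAt_to_inv]
  have hsymm := ((contDiffAt_chartFun (k := ⊤) hf).isSymmSndFDerivAt
    (by simpa using (mod_cast le_top : ((2 : ℕ∞) : WithTop ℕ∞) ≤ ∞))).eq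
    (fieldDeriv X φ y) (fieldDeriv Y φ y)
  rw [key hX hY, key hY hX, fieldDeriv, mvfderiv_eq_chartFun (mem_chart_source _ y)
    (hf.mdifferentiableAt (by simp))]
  change fderiv ℝ (chartFun y f) (φ y) (fieldDeriv (bracket X Y) φ y) = _
  rw [hself, hb, VectorField.lieBracket, map_sub, hc, hc, hsymm]
  abel

end Calculus

/-! ### Phase space valued functions on a manifold -/

section PhaseValued

open Filter Topology

/-- The standard symplectic form as a continuous bilinear map. -/
def omegaCLM : Phase n →L[ℝ] Phase n →L[ℝ] ℝ := LinearMap.toContinuousBilinearMap omega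

lemma omegaCLM_apply (x y : Phase n) : omegaCLM x y = omega x y := rfl

/-- The action of a matrix on phase space as a continuous linear map. -/
def mulVecCLM (A : Sp n) : Phase n →L[ℝ] Phase n :=
  LinearMap.toContinuousLinearMap (Matrix.toLin' A.1)

lemma mulVecCLM_apply (A : Sp n) (x : Phase n) : mulVecCLM A x = A.1 *ᵥ x := by
  simp [mulVecCLM]

lemma omega_self (x : Phase n) : omega x x = 0 := by
  have := omega_neg_swap x x
  linarith

variable {d : ℕ} {M : Type*} [TopologicalSpace M] [ChartedSpace (EuclideanSpace ℝ (Fin d)) M]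
   {f g : M → Phase n} {p : M}

section Regularity

lemma contMDiffAt_omega {k : WithTop ℕ∞} (hf : ContMDiffAt (𝓡 d) 𝓘(ℝ, Phase n) k f p)
    (hg : ContMDiffAt (𝓡 d) 𝓘(ℝ, Phase n) k g p) :
    ContMDiffAt (𝓡 d) 𝓘(ℝ, ℝ) k (fun q => omega (f q) (g q)) p :=
  ContMDiffAt.clm_apply (g := fun q => omegaCLM (f q))
    (omegaCLM.contDiff.contMDiff.contMDiffAt.comp p hf) hg

lemma mdifferentiableAt_omega (hf : MDifferentiableAt (𝓡 d) 𝓘(ℝ, Phase n) f p)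
    (hg : MDifferentiableAt (𝓡 d) 𝓘(ℝ, Phase n) g p) :
    MDifferentiableAt (𝓡 d) 𝓘(ℝ, ℝ) (fun q => omega (f q) (g q)) p :=
  MDifferentiableAt.clm_apply (g := fun q => omegaCLM (f q))
    (omegaCLM.differentiable.mdifferentiable.mdifferentiableAt.comp p hf) hg

lemma contMDiffAt_mulVec (A : Sp n) {k : WithTop ℕ∞}
    (hf : ContMDiffAt (𝓡 d) 𝓘(ℝ, Phase n) k f p) :
    ContMDiffAt (𝓡 d) 𝓘(ℝ, Phase n) k (fun q => A.1 *ᵥ f q) p := by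
  simp only [← mulVecCLM_apply]
  exact (mulVecCLM A).contDiff.contMDiff.contMDiffAt.comp p hf

lemma mdifferentiableAt_mulVec (A : Sp n) (hf : MDifferentiableAt (𝓡 d) 𝓘(ℝ, Phase n) f p) :
    MDifferentiableAt (𝓡 d) 𝓘(ℝ, Phase n) (fun q => A.1 *ᵥ f q) p := by
  simp only [← mulVecCLM_apply]
  exact (mulVecCLM A).differentiable.mdifferentiable.mdifferentiableAt.comp p hf

lemma mvfderiv_mulVec (A : Sp n) (hf : MDifferentiableAt (𝓡 d) 𝓘(ℝ, Phase n) f p)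
    (v : TangentSpace (𝓡 d) p) :
    mvfderiv (𝓡 d) (fun q => A.1 *ᵥ f q) p v = A.1 *ᵥ mvfderiv (𝓡 d) f p v := by
  simp only [← mulVecCLM_apply]
  exact mvfderiv_clm _ hf v

lemma mvfderiv_omega [IsManifold (𝓡 d) ∞ M] (hf : MDifferentiableAt (𝓡 d) 𝓘(ℝ, Phase n) f p)
    (hg : MDifferentiableAt (𝓡 d) 𝓘(ℝ, Phase n) g p) (v : TangentSpace (𝓡 d) p) :
    mvfderiv (𝓡 d) (fun q => omega (f q) (g q)) p v
      = omega (mvfderiv (𝓡 d) f p v) (g p) + omega (f p) (mvfderiv (𝓡 d) g p v) := by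
  have hp := mem_chart_source (EuclideanSpace ℝ (Fin d)) p
  rw [mvfderiv_eq_chartFun hp hf, mvfderiv_eq_chartFun hp hg,
    mvfderiv_eq_chartFun hp (mdifferentiableAt_omega hf hg)]
  have h := omegaCLM.hasFDerivAt_of_bilinear (differentiableAt_chartFun hp hf).hasFDerivAt
    (differentiableAt_chartFun hp hg).hasFDerivAt
  have h2 : fderiv ℝ (chartFun p fun q => omega (f q) (g q)) (extChartAt (𝓡 d) p p) = _ := h.fderiv
  rw [h2]
  simp only [add_apply, ContinuousLinearMap.precompR_apply, ContinuousLinearMap.precompL_apply,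
    chartFun, extChartAt_to_inv, omegaCLM_apply]
  rw [add_comm]
  rfl

end Regularity

variable [IsManifold (𝓡 d) ∞ M]

lemma fieldDeriv_omega (X : VField d M) (hf : MDifferentiableAt (𝓡 d) 𝓘(ℝ, Phase n) f p)
    (hg : MDifferentiableAt (𝓡 d) 𝓘(ℝ, Phase n) g p) :
    fieldDeriv X (fun q => omega (f q) (g q)) p
      = omega (fieldDeriv X f p) (g p) + omega (f p) (fieldDeriv X g p) :=
  mvfderiv_omega hf hg _

/-! ### The horizontal part of the derivative of a map to a quadric -/

variable (A : Sp n) (μ₀ : ℝ) (σ : M → Phase n)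

/-- The coefficient of the vertical correction. -/
def vertCoeff (p : M) : TangentSpace (𝓡 d) p →ₗ[ℝ] ℝ :=
  (1 / μ₀) • (omega.flip (σ p) ∘ₗ (mvfderiv (𝓡 d) σ p).toLinearMap)

/-- The projection of the derivative of `σ` along `Aσ` to the hyperplane `σ^⊥`. -/
def horDeriv (p : M) : TangentSpace (𝓡 d) p →ₗ[ℝ] Phase n :=
  (mvfderiv (𝓡 d) σ p).toLinearMap + (vertCoeff μ₀ σ p).smulRight (A.1 *ᵥ σ p)

/-- The derivative twisted by the vertical coefficient. -/
def twistDeriv (X : VField d M) (f : M → Phase n) (p : M) : Phase n :=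
  fieldDeriv X f p + vertCoeff μ₀ σ p (X p) • (A.1 *ᵥ f p)

omit [IsManifold (𝓡 d) ∞ M] in
lemma vertCoeff_apply (p : M) (v : TangentSpace (𝓡 d) p) :
    vertCoeff μ₀ σ p v = 1 / μ₀ * omega (mvfderiv (𝓡 d) σ p v) (σ p) := rfl

omit [IsManifold (𝓡 d) ∞ M] in
lemma horDeriv_apply (p : M) (v : TangentSpace (𝓡 d) p) :
    horDeriv A μ₀ σ p v = mvfderiv (𝓡 d) σ p v + vertCoeff μ₀ σ p v • (A.1 *ᵥ σ p) := rfl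

omit [IsManifold (𝓡 d) ∞ M] in
lemma horDeriv_eq_twistDeriv (X : VField d M) (p : M) :
    horDeriv A μ₀ σ p (X p) = twistDeriv A μ₀ σ X σ p := rfl

variable {A μ₀ σ} {y : M}

lemma mdifferentiableAt_vertCoeff {X : VField d M} (hσ : ContMDiffAt (𝓡 d) 𝓘(ℝ, Phase n) ∞ σ y)
    (hX : DiffAt X y) :
    MDifferentiableAt (𝓡 d) 𝓘(ℝ, ℝ) (fun p => vertCoeff μ₀ σ p (X p)) y :=
  MDifferentiableAt.mul mdifferentiableAt_const (mdifferentiableAt_omega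
    (mdifferentiableAt_fieldDeriv hσ hX) (hσ.mdifferentiableAt (by simp)))

lemma contMDiffAt_vertCoeff {X : VField d M} (hσ : ContMDiffAt (𝓡 d) 𝓘(ℝ, Phase n) ∞ σ y)
    (hX : SmoothAt X y) :
    ContMDiffAt (𝓡 d) 𝓘(ℝ, ℝ) ∞ (fun p => vertCoeff μ₀ σ p (X p)) y :=
  ContMDiffAt.mul contMDiffAt_const (contMDiffAt_omega (contMDiffAt_fieldDeriv hσ hX) hσ)

lemma contMDiffAt_twistDeriv {X : VField d M} {f : M → Phase n}
    (hσ : ContMDiffAt (𝓡 d) 𝓘(ℝ, Phase n) ∞ σ y) (hf : ContMDiffAt (𝓡 d) 𝓘(ℝ, Phase n) ∞ f y)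
    (hX : SmoothAt X y) :
    ContMDiffAt (𝓡 d) 𝓘(ℝ, Phase n) ∞ (twistDeriv A μ₀ σ X f) y :=
  ContMDiffAt.add (contMDiffAt_fieldDeriv hf hX)
    (ContMDiffAt.smul (contMDiffAt_vertCoeff hσ hX) (contMDiffAt_mulVec A hf))

omit [IsManifold (𝓡 d) ∞ M] in
lemma twistDeriv_congr {f g : M → Phase n} (X : VField d M) (h : f =ᶠ[𝓝 y] g) :
    twistDeriv A μ₀ σ X f y = twistDeriv A μ₀ σ X g y := by
  rw [twistDeriv, twistDeriv, fieldDeriv_congr X h, h.eq_of_nhds]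

omit [IsManifold (𝓡 d) ∞ M] in
lemma twistDeriv_add (X : VField d M) (hf : MDifferentiableAt (𝓡 d) 𝓘(ℝ, Phase n) f y)
    (hg : MDifferentiableAt (𝓡 d) 𝓘(ℝ, Phase n) g y) :
    twistDeriv A μ₀ σ X (fun p => f p + g p) y
      = twistDeriv A μ₀ σ X f y + twistDeriv A μ₀ σ X g y := by
  have h := congrArg (fun L => L (X y)) (mvfderiv_fun_add hf hg)
  simp only [twistDeriv, fieldDeriv, Matrix.mulVec_add, smul_add]
  simp only [add_apply] at h
  rw [h]
  abel

omit [IsManifold (𝓡 d) ∞ M] in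
lemma twistDeriv_smul (X : VField d M) {a : M → ℝ} (ha : MDifferentiableAt (𝓡 d) 𝓘(ℝ, ℝ) a y)
    (hf : MDifferentiableAt (𝓡 d) 𝓘(ℝ, Phase n) f y) :
    twistDeriv A μ₀ σ X (fun p => a p • f p) y
      = fieldDeriv X a y • f y + a y • twistDeriv A μ₀ σ X f y := by
  have h := congrArg (fun L => L (X y)) (mvfderiv_fun_smul ha hf)
  simp only [twistDeriv, fieldDeriv, Matrix.mulVec_smul, smul_add]
  simp only [add_apply, smul_apply, ContinuousLinearMap.smulRight_apply] at h
  rw [h, smul_comm (a y)]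
  abel

omit [IsManifold (𝓡 d) ∞ M] in
lemma twistDeriv_mulVec (X : VField d M) (hf : MDifferentiableAt (𝓡 d) 𝓘(ℝ, Phase n) f y) :
    twistDeriv A μ₀ σ X (fun p => A.1 *ᵥ f p) y = A.1 *ᵥ twistDeriv A μ₀ σ X f y := by
  rw [twistDeriv, fieldDeriv, mvfderiv_mulVec A hf, twistDeriv, Matrix.mulVec_add,
    Matrix.mulVec_smul, fieldDeriv]

/-- The extra terms `c ω(Af, g) + c ω(f, Ag)` cancel because `A` is skew for `ω`. -/
lemma fieldDeriv_omega_eq_twistDeriv (X : VField d M)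
    (hf : MDifferentiableAt (𝓡 d) 𝓘(ℝ, Phase n) f y)
    (hg : MDifferentiableAt (𝓡 d) 𝓘(ℝ, Phase n) g y) :
    fieldDeriv X (fun q => omega (f q) (g q)) y
      = omega (twistDeriv A μ₀ σ X f y) (g y) + omega (f y) (twistDeriv A μ₀ σ X g y) := by
  rw [fieldDeriv_omega X hf hg]
  simp only [twistDeriv, map_add, map_smul, LinearMap.add_apply, LinearMap.smul_apply, smul_eq_mul,
    omega_mulVec_left]
  ring

/-- The curvature of the twisted derivative. -/
lemma twistDeriv_comm {X Y : VField d M} {f : M → Phase n}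
    (hσ : ContMDiffAt (𝓡 d) 𝓘(ℝ, Phase n) ∞ σ y) (hf : ContMDiffAt (𝓡 d) 𝓘(ℝ, Phase n) ∞ f y)
    (hX : SmoothAt X y) (hY : SmoothAt Y y) :
    twistDeriv A μ₀ σ X (twistDeriv A μ₀ σ Y f) y - twistDeriv A μ₀ σ Y (twistDeriv A μ₀ σ X f) y
        - twistDeriv A μ₀ σ (bracket X Y) f y
      = (-2 / μ₀ * omega (fieldDeriv X σ y) (fieldDeriv Y σ y)) • (A.1 *ᵥ f y) := by
  -- Under antisymmetrization in `X` and `Y` the terms with one or two factors `c` cancel. The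
  -- second derivatives of `f` and `σ` assemble into the bracket term, and `ω(Yσ, Xσ) / μ₀` is
  -- doubled.
  have key : ∀ {X Y : VField d M}, SmoothAt X y → SmoothAt Y y →
      twistDeriv A μ₀ σ X (twistDeriv A μ₀ σ Y f) y
        = fieldDeriv X (fieldDeriv Y f) y
          + vertCoeff μ₀ σ y (X y) • (A.1 *ᵥ fieldDeriv Y f y)
          + (1 / μ₀ * (omega (fieldDeriv X (fieldDeriv Y σ) y) (σ y)
            + omega (fieldDeriv Y σ y) (fieldDeriv X σ y))) • (A.1 *ᵥ f y)
          + vertCoeff μ₀ σ y (Y y) • (A.1 *ᵥ fieldDeriv X f y)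
          + (vertCoeff μ₀ σ y (Y y) * vertCoeff μ₀ σ y (X y)) • (A.1 *ᵥ (A.1 *ᵥ f y)) := by
    intro X Y hX hY
    have hfd := hf.mdifferentiableAt (by simp)
    have hσd := hσ.mdifferentiableAt (by simp)
    have hYf := (contMDiffAt_fieldDeriv hf hY).mdifferentiableAt (by simp)
    have hYσ := (contMDiffAt_fieldDeriv hσ hY).mdifferentiableAt (by simp)
    have h1 : twistDeriv A μ₀ σ X (twistDeriv A μ₀ σ Y f) y
        = twistDeriv A μ₀ σ X (fieldDeriv Y f) y
          + twistDeriv A μ₀ σ X (fun p => vertCoeff μ₀ σ p (Y p) • (A.1 *ᵥ f p)) y :=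
      twistDeriv_add X hYf (MDifferentiableAt.smul (mdifferentiableAt_vertCoeff hσ hY.diffAt)
        (mdifferentiableAt_mulVec A hfd))
    have h2 : fieldDeriv X (fun p => vertCoeff μ₀ σ p (Y p)) y
        = 1 / μ₀ * (omega (fieldDeriv X (fieldDeriv Y σ) y) (σ y)
            + omega (fieldDeriv Y σ y) (fieldDeriv X σ y)) := by
      have h := congrArg (fun L => L (X y))
        (mvfderiv_fun_smul (mdifferentiableAt_const (c := 1 / μ₀))
        (mdifferentiableAt_omega hYσ hσd))
      rw [mvfderiv_const] at h
      simp only [add_apply, smul_apply, ContinuousLinearMap.smulRight_apply, zero_apply,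
        zero_smul, add_zero] at h
      rw [mvfderiv_omega hYσ hσd] at h
      exact h
    rw [h1, twistDeriv_smul X (mdifferentiableAt_vertCoeff hσ hY.diffAt)
      (mdifferentiableAt_mulVec A hfd), twistDeriv_mulVec X hfd, h2]
    simp only [twistDeriv, Matrix.mulVec_add, Matrix.mulVec_smul]
    module
  rw [key hX hY, key hY hX, twistDeriv, fieldDeriv_bracket hf hX hY, vertCoeff_apply (p := y)]
  change _ - (_ + (1 / μ₀ * omega (fieldDeriv (bracket X Y) σ y) (σ y)) • _) = _
  rw [fieldDeriv_bracket hσ hX hY, omega_neg_swap (fieldDeriv Y σ y)]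
  simp only [map_sub, LinearMap.sub_apply]
  module

end PhaseValued

/-! ### The reduced objects in terms of a local section -/

section LocalModel

open Filter Topology

lemma eq_zero_of_omega_eq_zero {x : Phase n} (h : ∀ y, omega x y = 0) : x = 0 := by
  funext j
  rcases j with i | i
  · have := h (Pi.single (Sum.inr i) 1)
    rw [omega_apply, Finset.sum_eq_single i] at this
    · simpa using this
    · intro j _ hj; simp [hj]
    · simp
  · have := h (Pi.single (Sum.inl i) 1)
    rw [omega_apply, Finset.sum_eq_single i] at this
    · simpa using this
    · intro j _ hj; simp [hj]
    · simp

variable {d : ℕ} {M : Type*} [TopologicalSpace M] [ChartedSpace (EuclideanSpace ℝ (Fin d)) M]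

/-! ### The horizontal derivative as a smooth family of operators -/

section HorDeriv

variable [IsManifold (𝓡 d) ∞ M] {A : Sp n} {μ₀ : ℝ} {σ : M → Phase n} {y : M}

-- If `P` is a left inverse of `T y`, then `P ∘ T p` is the identity at `p = y`, hence invertible
-- nearby, and `(P ∘ T p)⁻¹ ∘ P` is a left inverse of `T p`. It is smooth in `p` because inversion
-- is smooth on units.
omit [IsManifold (𝓡 d) ∞ M] in
lemma exists_contMDiffAt_leftInverse {E F : Type*} [NormedAddCommGroup E] [NormedSpace ℝ E]
    [FiniteDimensional ℝ E] [NormedAddCommGroup F] [NormedSpace ℝ F] [FiniteDimensional ℝ F]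
    {T : M → E →L[ℝ] F} (hT : ContMDiffAt (𝓡 d) 𝓘(ℝ, E →L[ℝ] F) ∞ T y)
    (hi : Function.Injective (T y)) :
    ∃ R : M → F →L[ℝ] E, ContMDiffAt (𝓡 d) 𝓘(ℝ, F →L[ℝ] E) ∞ R y ∧
      ∀ᶠ p in 𝓝 y, ∀ v, R p (T p v) = v := by
  have : CompleteSpace E := FiniteDimensional.complete ℝ E
  obtain ⟨P, hP⟩ := LinearMap.exists_leftInverse_of_injective (T y).toLinearMap
    (LinearMap.ker_eq_bot.2 hi)
  set L : F →L[ℝ] E := LinearMap.toContinuousLinearMap P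
  set K : M → E →L[ℝ] E := fun p => L ∘L T p
  have hK : ContMDiffAt (𝓡 d) 𝓘(ℝ, E →L[ℝ] E) ∞ K y := ContMDiffAt.clm_comp contMDiffAt_const hT
  have hKy : K y = ((1 : (E →L[ℝ] E)ˣ) : E →L[ℝ] E) := by
    ext1 v
    exact congrArg (fun L => L v) hP
  have hKu : ∀ᶠ p in 𝓝 y, IsUnit (K p) := by
    refine hK.continuousAt.eventually ?_
    rw [hKy]
    exact Units.nhds 1
  have hKi : ContMDiffAt (𝓡 d) 𝓘(ℝ, E →L[ℝ] E) ∞ (fun p => Ring.inverse (K p)) y := by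
    refine ContMDiffAt.comp (g := Ring.inverse) y (ContDiffAt.contMDiffAt ?_) hK
    rw [hKy]
    exact contDiffAt_ringInverse ℝ _
  refine ⟨fun p => Ring.inverse (K p) ∘L L, hKi.clm_comp contMDiffAt_const, ?_⟩
  filter_upwards [hKu] with p hu v
  exact congrArg (fun R => R v) (Ring.inverse_mul_cancel _ hu)

/-- The horizontal derivative is `dσ` followed by `v ↦ v + (ω(v, σ) / μ₀) Aσ`. Reading `dσ` in the
fixed chart at `y` turns this into a family of operators between two fixed vector spaces. -/
lemma exists_contMDiffAt_horDeriv_eq (A : Sp n) (μ₀ : ℝ)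
    (hσ : ContMDiffAt (𝓡 d) 𝓘(ℝ, Phase n) ∞ σ y) :
    ∃ T : M → EuclideanSpace ℝ (Fin d) →L[ℝ] Phase n,
      ContMDiffAt (𝓡 d) 𝓘(ℝ, EuclideanSpace ℝ (Fin d) →L[ℝ] Phase n) ∞ T y ∧
      ∀ᶠ p in 𝓝 y, ∀ v : TangentSpace (𝓡 d) p,
        horDeriv A μ₀ σ p v = T p (mvfderiv (𝓡 d) (extChartAt (𝓡 d) y) p v) := by
  have hQ : ContDiff ℝ ∞ fun x : Phase n => ContinuousLinearMap.id ℝ (Phase n)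
      + ((1 / μ₀) • omegaCLM.flip x).smulRight (mulVecCLM A x) :=
    contDiff_const.add ((omegaCLM.flip.contDiff.const_smul (1 / μ₀)).smulRight
      (mulVecCLM A).contDiff)
  refine ⟨fun p => (ContinuousLinearMap.id ℝ (Phase n)
      + ((1 / μ₀) • omegaCLM.flip (σ p)).smulRight (mulVecCLM A (σ p)))
        ∘L fderiv ℝ (chartFun y σ) (extChartAt (𝓡 d) y p),
    ContMDiffAt.clm_comp (hQ.contMDiff.contMDiffAt.comp y hσ)
      ((contDiffAt_fderiv_chartFun hσ).contMDiffAt.comp y contMDiffAt_extChartAt), ?_⟩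
  filter_upwards [eventually_mem_chart_source (d := d) y, eventually_mdifferentiableAt hσ]
    with p hp hd v
  rw [horDeriv_apply, vertCoeff_apply, mvfderiv_eq_chartFun hp hd, ← mulVecCLM_apply]
  rfl

/-- Vectors of the tangent space are determined by their horizontal images, so a field with smooth
horizontal image is smooth. -/
lemma smoothAt_of_contMDiffAt_horDeriv (hσ : ContMDiffAt (𝓡 d) 𝓘(ℝ, Phase n) ∞ σ y)
    (hi : Function.Injective (horDeriv (d := d) A μ₀ σ y)) {W : VField d M}
    (hW : ContMDiffAt (𝓡 d) 𝓘(ℝ, Phase n) ∞ (fun p => horDeriv A μ₀ σ p (W p)) y) :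
    SmoothAt W y := by
  obtain ⟨T, hT, hTe⟩ := exists_contMDiffAt_horDeriv_eq A μ₀ hσ
  -- The differential of the chart at its base point is the identity, so `T y` is the horizontal
  -- derivative at `y`.
  have hTi : Function.Injective (T y) := by
    intro v w hvw
    have h := hTe.self_of_nhds
    have hid : ∀ v : TangentSpace (𝓡 d) y, mvfderiv (𝓡 d) (extChartAt (𝓡 d) y) y v = v := fun v =>
      congrArg (fun L => L v) (mfderiv_extChartAt_self (I := 𝓡 d) (x := y))
    have h1 := (h v).trans (congrArg (T y) (hid v))
    have h2 := (h w).trans (congrArg (T y) (hid w))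
    exact hi (h1.trans (hvw.trans h2.symm))
  obtain ⟨R, hR, hRe⟩ := exists_contMDiffAt_leftInverse hT hTi
  rw [smoothAt_iff_chart]
  refine ContMDiffAt.congr_of_eventuallyEq (hR.clm_apply hW) ?_
  filter_upwards [hTe, hRe] with p hp hu
  rw [hp, hu]
  rfl

-- Used when the reduced connection is iterated. The twisted derivative of `σ` along `X` is the lift
-- of `X`, so the corrections along `σ` and `Aσ` contribute horizontal vectors and their images
-- under `A`.
omit [IsManifold (𝓡 d) ∞ M] in
lemma twistDeriv_add_smul_add_smul {w : M → Phase n} {a b : M → ℝ} (X : VField d M)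
    (hσ : MDifferentiableAt (𝓡 d) 𝓘(ℝ, Phase n) σ y)
    (hw : MDifferentiableAt (𝓡 d) 𝓘(ℝ, Phase n) w y)
    (ha : MDifferentiableAt (𝓡 d) 𝓘(ℝ, ℝ) a y) (hb : MDifferentiableAt (𝓡 d) 𝓘(ℝ, ℝ) b y) :
    twistDeriv A μ₀ σ X (fun p => w p + a p • σ p + b p • (A.1 *ᵥ σ p)) y
      = twistDeriv A μ₀ σ X w y + (fieldDeriv X a y • σ y + a y • horDeriv A μ₀ σ y (X y))
        + (fieldDeriv X b y • (A.1 *ᵥ σ y) + b y • (A.1 *ᵥ horDeriv A μ₀ σ y (X y))) := by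
  have hA := mdifferentiableAt_mulVec A hσ
  rw [twistDeriv_add (f := fun p => w p + a p • σ p) (g := fun p => b p • (A.1 *ᵥ σ p)) X
      (hw.add (ha.smul hσ)) (hb.smul hA),
    twistDeriv_add (g := fun p => a p • σ p) X hw (ha.smul hσ),
    twistDeriv_smul X ha hσ, twistDeriv_smul X hb hA,
    twistDeriv_mulVec X hσ, horDeriv_eq_twistDeriv]

/-! The derivatives of a map to the quadric are tangent, their horizontal parts horizontal. -/

/-- The form `ω(·, Aσ)` is half the differential of `H` at `σ`, and `H ∘ σ` is locally constant. -/
lemma omega_mvfderiv_mulVec {p : M} (hl : ∀ᶠ q in 𝓝 p, ham A (σ q) = μ₀)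
    (hd : MDifferentiableAt (𝓡 d) 𝓘(ℝ, Phase n) σ p) (u : TangentSpace (𝓡 d) p) :
    omega (mvfderiv (𝓡 d) σ p u) (A.1 *ᵥ σ p) = 0 := by
  have h1 := mvfderiv_omega hd (mdifferentiableAt_mulVec A hd) u
  have h2 : (fun q => omega (σ q) (A.1 *ᵥ σ q)) =ᶠ[𝓝 p] fun _ => μ₀ := hl
  rw [mvfderiv_congr h2, mvfderiv_const, mvfderiv_mulVec A hd, zero_apply,
    omega_mulVec_symm A (σ p)] at h1
  linarith

-- This is what fixes the factor `1 / μ₀` in `vertCoeff`: `ω(Aσ, σ) = -μ₀`.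
omit [IsManifold (𝓡 d) ∞ M] in
lemma omega_horDeriv_self [NeZero μ₀] {p : M} (hl : ham A (σ p) = μ₀)
    (u : TangentSpace (𝓡 d) p) : omega (horDeriv A μ₀ σ p u) (σ p) = 0 := by
  have h0 := NeZero.ne μ₀
  rw [ham] at hl
  simp only [horDeriv_apply, vertCoeff_apply, map_add, map_smul, LinearMap.add_apply,
    LinearMap.smul_apply, smul_eq_mul, omega_mulVec_left, hl]
  field_simp
  ring

lemma omega_horDeriv_mulVec {p : M} (hl : ∀ᶠ q in 𝓝 p, ham A (σ q) = μ₀)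
    (hd : MDifferentiableAt (𝓡 d) 𝓘(ℝ, Phase n) σ p) (u : TangentSpace (𝓡 d) p) :
    omega (horDeriv A μ₀ σ p u) (A.1 *ᵥ σ p) = 0 := by
  simp only [horDeriv_apply, map_add, map_smul, LinearMap.add_apply,
    LinearMap.smul_apply, smul_eq_mul, omega_mvfderiv_mulVec hl hd, omega_self]
  ring

end HorDeriv

/-- The section `σ` of a quadric over a neighbourhood of `y` expresses a form, an endomorphism and a
connection as the horizontal parts of the objects of phase space. -/
structure IsLocalModel [IsManifold (𝓡 d) 1 M] (A : Sp n) (μ₀ : ℝ) (σ : M → Phase n)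
    (Ω : BilinField d M) (B : EndField d M)
    (D : Connection d M) (y : M) : Prop where
  smooth : ContMDiffAt (𝓡 d) 𝓘(ℝ, Phase n) ∞ σ y
  level : ∀ᶠ p in 𝓝 y, ham A (σ p) = μ₀
  injective : Function.Injective (horDeriv (d := d) A μ₀ σ y)
  surjective : ∀ w, omega w (σ y) = 0 → omega w (A.1 *ᵥ σ y) = 0 →
    ∃ u, horDeriv (d := d) A μ₀ σ y u = w
  form : ∀ᶠ p in 𝓝 y, ∀ u v,
    Ω p u v = omega (horDeriv A μ₀ σ p u) (horDeriv A μ₀ σ p v)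
  endo : ∀ u, horDeriv A μ₀ σ y (B y u) = A.1 *ᵥ horDeriv A μ₀ σ y u
    - (1 / μ₀ * omega (A.1 *ᵥ horDeriv A μ₀ σ y u) (A.1 *ᵥ σ y)) • σ y
  conn : ∀ᶠ p in 𝓝 y, ∀ Z : VField d M, DiffAt Z p → ∀ u, horDeriv A μ₀ σ p (D Z p u)
    = mvfderiv (𝓡 d) (fun q => horDeriv A μ₀ σ q (Z q)) p u
      + vertCoeff μ₀ σ p u • (A.1 *ᵥ horDeriv A μ₀ σ p (Z p))
      + (1 / μ₀ * omega (horDeriv A μ₀ σ p (Z p)) (A.1 *ᵥ horDeriv A μ₀ σ p u)) • σ p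
      + (1 / μ₀ * omega (horDeriv A μ₀ σ p u) (horDeriv A μ₀ σ p (Z p))) • (A.1 *ᵥ σ p)

/-! ### The form, torsion and curvature computed in a local model -/

namespace IsLocalModel

variable [IsManifold (𝓡 d) ∞ M] {A : Sp n} {μ₀ : ℝ} {σ : M → Phase n}
  {Ω : BilinField d M} {B : EndField d M} {D : Connection d M} {y : M}
  {X Y Z : VField d M}

lemma omega_mvfderiv (h : IsLocalModel A μ₀ σ Ω B D y) :
    ∀ᶠ p in 𝓝 y, ∀ u, omega (mvfderiv (𝓡 d) σ p u) (A.1 *ᵥ σ p) = 0 := by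
  filter_upwards [eventually_eventually_nhds.2 h.level, eventually_mdifferentiableAt h.smooth]
    with p hp hd u using omega_mvfderiv_mulVec hp hd u

lemma omega_horDeriv_left [NeZero μ₀] (h : IsLocalModel A μ₀ σ Ω B D y) :
    ∀ᶠ p in 𝓝 y, ∀ u : TangentSpace (𝓡 d) p, omega (horDeriv A μ₀ σ p u) (σ p) = 0 := by
  filter_upwards [h.level] with p hp u using omega_horDeriv_self hp u

lemma omega_horDeriv_right (h : IsLocalModel A μ₀ σ Ω B D y) :
    ∀ᶠ p in 𝓝 y, ∀ u : TangentSpace (𝓡 d) p, omega (horDeriv A μ₀ σ p u) (A.1 *ᵥ σ p) = 0 := by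
  filter_upwards [eventually_eventually_nhds.2 h.level, eventually_mdifferentiableAt h.smooth]
    with p hp hd u using omega_horDeriv_mulVec hp hd u

/-- The vertical corrections are invisible to `ω`, since `ω(dσ(u), Aσ) = 0`. Thus `Ω` is the
pull-back of `ω` by `σ`, and its derivatives and brackets can be computed from `σ` alone. -/
lemma form_eq (h : IsLocalModel A μ₀ σ Ω B D y) : ∀ᶠ p in 𝓝 y, ∀ u v,
    Ω p u v = omega (mvfderiv (𝓡 d) σ p u) (mvfderiv (𝓡 d) σ p v) := by
  filter_upwards [h.form, h.omega_mvfderiv] with p hf hp u v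
  rw [hf]
  simp only [horDeriv_apply, map_add, map_smul, LinearMap.add_apply,
    LinearMap.smul_apply, smul_eq_mul, hp, omega_self,
    omega_neg_swap (A.1 *ᵥ σ p) (mvfderiv (𝓡 d) σ p v)]
  ring

/-- The plane spanned by `σ` and `Aσ` meets the horizontal space only in zero, because `ω(σ, Aσ) =
μ₀ ≠ 0`. Identities between tangent vectors need only be checked modulo `σ` and `Aσ`. -/
lemma eq_of_horDeriv [NeZero μ₀] (h : IsLocalModel A μ₀ σ Ω B D y)
    {u v : TangentSpace (𝓡 d) y} (a b : ℝ)
    (huv : horDeriv A μ₀ σ y u - horDeriv A μ₀ σ y v = a • σ y + b • (A.1 *ᵥ σ y)) : u = v := by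
  have h0 := NeZero.ne μ₀
  have hl := h.level.self_of_nhds
  have h1 := h.omega_horDeriv_left.self_of_nhds
  have h2 := h.omega_horDeriv_right.self_of_nhds
  have e1 := congrArg (fun w => omega w (σ y)) huv
  have e2 := congrArg (fun w => omega w (A.1 *ᵥ σ y)) huv
  rw [ham] at hl
  simp only [map_add, map_sub, map_smul, LinearMap.add_apply, LinearMap.sub_apply,
    LinearMap.smul_apply, smul_eq_mul, h1, h2, omega_self, omega_mulVec_left (A := A) (σ y) (σ y),
    hl] at e1 e2
  have hb : b = 0 := by
    have : b * μ₀ = 0 := by linarith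
    simpa [h0] using this
  have ha : a = 0 := by
    have : a * μ₀ = 0 := by linarith
    simpa [h0] using this
  rw [ha, hb] at huv
  apply h.injective
  rw [← sub_eq_zero, huv]
  simp

lemma alternating (h : IsLocalModel A μ₀ σ Ω B D y) (u : TangentSpace (𝓡 d) y) : Ω y u u = 0 := by
  rw [h.form.self_of_nhds, omega_self]

lemma nondegenerate [NeZero μ₀] (h : IsLocalModel A μ₀ σ Ω B D y) (u : TangentSpace (𝓡 d) y)
    (hu : ∀ v, Ω y u v = 0) : u = 0 := by
  have h0 := NeZero.ne μ₀
  have hl := h.level.self_of_nhds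
  have h1 := h.omega_horDeriv_left.self_of_nhds
  have h2 := h.omega_horDeriv_right.self_of_nhds
  rw [ham] at hl
  apply h.injective
  rw [map_zero]
  apply eq_zero_of_omega_eq_zero
  intro w
  obtain ⟨v, hv⟩ := h.surjective
    -- This is the projection of `w` to the horizontal space along `σ` and `Aσ`; the removed part
    -- pairs to zero with horizontal vectors.
    (w - (μ₀⁻¹ * omega w (A.1 *ᵥ σ y)) • σ y + (μ₀⁻¹ * omega w (σ y)) • (A.1 *ᵥ σ y))
    (by
      simp only [map_add, map_sub, map_smul, LinearMap.add_apply, LinearMap.sub_apply,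
        LinearMap.smul_apply, smul_eq_mul, omega_self, omega_mulVec_left (A := A) (σ y) (σ y), hl]
      field_simp
      ring)
    (by
      simp only [map_add, map_sub, map_smul, LinearMap.add_apply, LinearMap.sub_apply,
        LinearMap.smul_apply, smul_eq_mul, omega_self, hl]
      field_simp
      ring)
  have h3 := hu v
  rw [h.form.self_of_nhds, hv] at h3
  simpa [h1, h2] using h3

lemma contMDiffAt_horDeriv (h : IsLocalModel A μ₀ σ Ω B D y) (hX : SmoothAt X y) :
    ContMDiffAt (𝓡 d) 𝓘(ℝ, Phase n) ∞ (fun p => horDeriv A μ₀ σ p (X p)) y :=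
  contMDiffAt_twistDeriv h.smooth h.smooth hX

lemma form_smooth (h : IsLocalModel A μ₀ σ Ω B D y) (hX : SmoothAt X y) (hY : SmoothAt Y y) :
    ContMDiffAt (𝓡 d) 𝓘(ℝ, ℝ) ∞ (fun p => Ω p (X p) (Y p)) y :=
  (contMDiffAt_omega (h.contMDiffAt_horDeriv hX) (h.contMDiffAt_horDeriv hY)).congr_of_eventuallyEq
    (h.form.mono fun _ hp => hp _ _)

lemma dirDeriv_form (h : IsLocalModel A μ₀ σ Ω B D y) (X : VField d M) (hY : SmoothAt Y y)
    (hZ : SmoothAt Z y) :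
    dirDeriv (fun p => Ω p (Y p) (Z p)) y (X y)
      = omega (fieldDeriv X (fieldDeriv Y σ) y) (fieldDeriv Z σ y)
        + omega (fieldDeriv Y σ y) (fieldDeriv X (fieldDeriv Z σ) y) := by
  have e : (fun p => Ω p (Y p) (Z p))
      =ᶠ[𝓝 y] fun p => omega (fieldDeriv Y σ p) (fieldDeriv Z σ p) :=
    h.form_eq.mono fun _ hp => hp _ _
  rw [dirDeriv, mvfderiv_congr e]
  exact fieldDeriv_omega X ((contMDiffAt_fieldDeriv h.smooth hY).mdifferentiableAt (by simp))
    ((contMDiffAt_fieldDeriv h.smooth hZ).mdifferentiableAt (by simp))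

lemma form_bracket (h : IsLocalModel A μ₀ σ Ω B D y) (hX : SmoothAt X y) (hY : SmoothAt Y y)
    (Z : VField d M) :
    Ω y (bracket X Y y) (Z y)
      = omega (fieldDeriv X (fieldDeriv Y σ) y) (fieldDeriv Z σ y)
        - omega (fieldDeriv Y (fieldDeriv X σ) y) (fieldDeriv Z σ y) := by
  rw [h.form_eq.self_of_nhds]
  change omega (fieldDeriv (bracket X Y) σ y) (fieldDeriv Z σ y) = _
  rw [fieldDeriv_bracket h.smooth hX hY, map_sub, LinearMap.sub_apply]

/-- Since `ω` is constant, every term becomes a pairing of a second derivative of `σ` with a first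
one, and these cancel by skew-symmetry. -/
lemma form_closed (h : IsLocalModel A μ₀ σ Ω B D y) (hX : SmoothAt X y) (hY : SmoothAt Y y)
    (hZ : SmoothAt Z y) :
    dirDeriv (fun p => Ω p (Y p) (Z p)) y (X y)
      + dirDeriv (fun p => Ω p (Z p) (X p)) y (Y y)
      + dirDeriv (fun p => Ω p (X p) (Y p)) y (Z y)
      - Ω y (bracket X Y y) (Z y) - Ω y (bracket Y Z y) (X y) - Ω y (bracket Z X y) (Y y) = 0 := by
  rw [h.dirDeriv_form X hY hZ, h.dirDeriv_form Y hZ hX, h.dirDeriv_form Z hX hY,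
    h.form_bracket hX hY, h.form_bracket hY hZ, h.form_bracket hZ hX,
    omega_neg_swap (fieldDeriv Y σ y), omega_neg_swap (fieldDeriv Z σ y),
    omega_neg_swap (fieldDeriv X σ y)]
  ring

lemma nabla_eq (h : IsLocalModel A μ₀ σ Ω B D y) : ∀ᶠ p in 𝓝 y, ∀ X Z : VField d M, DiffAt Z p →
    horDeriv A μ₀ σ p (D.nabla X Z p)
      = twistDeriv A μ₀ σ X (fun q => horDeriv A μ₀ σ q (Z q)) p
      + (1 / μ₀ * omega (horDeriv A μ₀ σ p (Z p)) (A.1 *ᵥ horDeriv A μ₀ σ p (X p))) • σ p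
      + (1 / μ₀ * omega (horDeriv A μ₀ σ p (X p)) (horDeriv A μ₀ σ p (Z p))) • (A.1 *ᵥ σ p) :=
  h.conn.mono fun _ hp X _ hZ => hp _ hZ (X _)

lemma nabla_eventuallyEq (h : IsLocalModel A μ₀ σ Ω B D y) (X : VField d M) (hZ : SmoothAt Z y) :
    (fun p => horDeriv A μ₀ σ p (D.nabla X Z p))
      =ᶠ[𝓝 y] fun p => twistDeriv A μ₀ σ X (fun q => horDeriv A μ₀ σ q (Z q)) p
      + (1 / μ₀ * omega (horDeriv A μ₀ σ p (Z p)) (A.1 *ᵥ horDeriv A μ₀ σ p (X p))) • σ p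
      + (1 / μ₀ * omega (horDeriv A μ₀ σ p (X p)) (horDeriv A μ₀ σ p (Z p))) • (A.1 *ᵥ σ p) := by
  filter_upwards [h.nabla_eq, hZ.eventually_diffAt] with p hp hpZ using hp X Z hpZ

lemma contMDiffAt_coeff_left (h : IsLocalModel A μ₀ σ Ω B D y) (hX : SmoothAt X y)
    (hZ : SmoothAt Z y) : ContMDiffAt (𝓡 d) 𝓘(ℝ, ℝ) ∞ (fun p =>
      1 / μ₀ * omega (horDeriv A μ₀ σ p (Z p)) (A.1 *ᵥ horDeriv A μ₀ σ p (X p))) y :=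
  ContMDiffAt.mul contMDiffAt_const (contMDiffAt_omega (h.contMDiffAt_horDeriv hZ)
    (contMDiffAt_mulVec A (h.contMDiffAt_horDeriv hX)))

lemma contMDiffAt_coeff_right (h : IsLocalModel A μ₀ σ Ω B D y) (hX : SmoothAt X y)
    (hZ : SmoothAt Z y) : ContMDiffAt (𝓡 d) 𝓘(ℝ, ℝ) ∞ (fun p =>
      1 / μ₀ * omega (horDeriv A μ₀ σ p (X p)) (horDeriv A μ₀ σ p (Z p))) y :=
  ContMDiffAt.mul contMDiffAt_const (contMDiffAt_omega (h.contMDiffAt_horDeriv hX)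
    (h.contMDiffAt_horDeriv hZ))

lemma smoothAt_nabla (h : IsLocalModel A μ₀ σ Ω B D y) (hX : SmoothAt X y) (hZ : SmoothAt Z y) :
    SmoothAt (D.nabla X Z) y := by
  refine smoothAt_of_contMDiffAt_horDeriv h.smooth h.injective
    (ContMDiffAt.congr_of_eventuallyEq ?_ (h.nabla_eventuallyEq X hZ))
  exact ContMDiffAt.add (ContMDiffAt.add
    (contMDiffAt_twistDeriv h.smooth (h.contMDiffAt_horDeriv hZ) hX)
    (ContMDiffAt.smul (h.contMDiffAt_coeff_left hX hZ) h.smooth))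
    (ContMDiffAt.smul (h.contMDiffAt_coeff_right hX hZ) (contMDiffAt_mulVec A h.smooth))

/-- The lift of `Y` is the twisted derivative of `σ` along `Y`. So `twistDeriv_comm` with `f = σ`
gives the lifted bracket up to `-(2/μ₀) Ω(X, Y) Aσ`, which the two corrections along `Aσ`
compensate. The corrections along `σ` cancel because `ω(·, A·)` is symmetric. -/
lemma torsion_free (h : IsLocalModel A μ₀ σ Ω B D y) (hX : SmoothAt X y) (hY : SmoothAt Y y) :
    D.nabla X Y y - D.nabla Y X y = bracket X Y y := by
  have h1 := h.nabla_eq.self_of_nhds X Y hY.diffAt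
  have h2 := h.nabla_eq.self_of_nhds Y X hX.diffAt
  have h3 := twistDeriv_comm (A := A) (μ₀ := μ₀) h.smooth h.smooth hX hY
  have h4 : omega (fieldDeriv X σ y) (fieldDeriv Y σ y)
      = omega (horDeriv A μ₀ σ y (X y)) (horDeriv A μ₀ σ y (Y y)) :=
    (h.form_eq.self_of_nhds (X y) (Y y)).symm.trans (h.form.self_of_nhds _ _)
  apply h.injective
  rw [map_sub, h1, h2, omega_mulVec_symm A (horDeriv A μ₀ σ y (Y y)),
    omega_neg_swap (horDeriv A μ₀ σ y (Y y)) (horDeriv A μ₀ σ y (X y)), ← h4]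
  change _ = twistDeriv A μ₀ σ (bracket X Y) σ y
  rw [← sub_eq_zero] at h3 ⊢
  rw [← h3]
  change (twistDeriv A μ₀ σ X (twistDeriv A μ₀ σ Y σ) y + _ + _)
    - (twistDeriv A μ₀ σ Y (twistDeriv A μ₀ σ X σ) y + _ + _) - _ = _
  module

/-- The twisted derivative satisfies the product rule for `ω`, and the corrections along `σ` and
`Aσ` pair to zero with horizontal vectors. -/
lemma parallel [NeZero μ₀] (h : IsLocalModel A μ₀ σ Ω B D y) (X : VField d M) (hY : SmoothAt Y y)
    (hZ : SmoothAt Z y) :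
    dirDeriv (fun p => Ω p (Y p) (Z p)) y (X y)
      = Ω y (D.nabla X Y y) (Z y) + Ω y (Y y) (D.nabla X Z y) := by
  have e : (fun p => Ω p (Y p) (Z p))
      =ᶠ[𝓝 y] fun p => omega (horDeriv A μ₀ σ p (Y p)) (horDeriv A μ₀ σ p (Z p)) :=
    h.form.mono fun _ hp => hp _ _
  have h1 := h.omega_horDeriv_left.self_of_nhds
  have h2 := h.omega_horDeriv_right.self_of_nhds
  rw [dirDeriv, mvfderiv_congr e, h.form.self_of_nhds, h.form.self_of_nhds,
    h.nabla_eq.self_of_nhds X Y hY.diffAt, h.nabla_eq.self_of_nhds X Z hZ.diffAt]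
  refine (fieldDeriv_omega_eq_twistDeriv (A := A) (μ₀ := μ₀) (σ := σ) X
    ((h.contMDiffAt_horDeriv hY).mdifferentiableAt (by simp))
    ((h.contMDiffAt_horDeriv hZ).mdifferentiableAt (by simp))).trans ?_
  simp only [map_add, map_smul, LinearMap.add_apply, LinearMap.smul_apply, smul_eq_mul, h1, h2,
    omega_neg_swap (σ y), omega_neg_swap (A.1 *ᵥ σ y)]
  ring

lemma endo_skew [NeZero μ₀] (h : IsLocalModel A μ₀ σ Ω B D y) (u v : TangentSpace (𝓡 d) y) :
    Ω y (B y u) v = - Ω y u (B y v) := by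
  have h1 := h.omega_horDeriv_left.self_of_nhds
  rw [h.form.self_of_nhds, h.form.self_of_nhds, h.endo, h.endo]
  simp only [map_sub, map_smul, LinearMap.sub_apply, LinearMap.smul_apply, smul_eq_mul, h1,
    omega_neg_swap (σ y), omega_mulVec_left A (horDeriv A μ₀ σ y u) (horDeriv A μ₀ σ y v)]
  ring

/-- The coefficients `a` and `b` are left unspecified, as only the class modulo `σ` and `Aσ` enters
the curvature. -/
lemma exists_nabla_nabla (h : IsLocalModel A μ₀ σ Ω B D y) (X : VField d M) (hY : SmoothAt Y y)
    (hZ : SmoothAt Z y) :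
    ∃ a b : ℝ, horDeriv A μ₀ σ y (D.nabla X (D.nabla Y Z) y)
      = twistDeriv A μ₀ σ X (twistDeriv A μ₀ σ Y (fun q => horDeriv A μ₀ σ q (Z q))) y
      + (1 / μ₀ * omega (horDeriv A μ₀ σ y (Z y)) (A.1 *ᵥ horDeriv A μ₀ σ y (Y y)))
        • horDeriv A μ₀ σ y (X y)
      + (1 / μ₀ * omega (horDeriv A μ₀ σ y (Y y)) (horDeriv A μ₀ σ y (Z y)))
        • (A.1 *ᵥ horDeriv A μ₀ σ y (X y)) + a • σ y + b • (A.1 *ᵥ σ y) := by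
  have h1 := h.nabla_eq.self_of_nhds X _ (h.smoothAt_nabla hY hZ).diffAt
  rw [twistDeriv_congr X (h.nabla_eventuallyEq Y hZ),
    twistDeriv_add_smul_add_smul X (h.smooth.mdifferentiableAt (by simp))
      ((contMDiffAt_twistDeriv (A := A) (μ₀ := μ₀) h.smooth
        (h.contMDiffAt_horDeriv hZ) hY).mdifferentiableAt (by simp))
      ((h.contMDiffAt_coeff_left hY hZ).mdifferentiableAt (by simp))
      ((h.contMDiffAt_coeff_right hY hZ).mdifferentiableAt (by simp))] at h1
  generalize hα : fieldDeriv X (fun p => 1 / μ₀ * omega (horDeriv A μ₀ σ p (Z p))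
    (A.1 *ᵥ horDeriv A μ₀ σ p (Y p))) y = α at h1
  generalize hβ : fieldDeriv X (fun p => 1 / μ₀ * omega (horDeriv A μ₀ σ p (Y p))
    (horDeriv A μ₀ σ p (Z p))) y = β at h1
  generalize 1 / μ₀ * omega (horDeriv A μ₀ σ y (D.nabla Y Z y))
    (A.1 *ᵥ horDeriv A μ₀ σ y (X y)) = γ at h1
  generalize 1 / μ₀ * omega (horDeriv A μ₀ σ y (X y)) (horDeriv A μ₀ σ y (D.nabla Y Z y)) = δ at h1
  -- Each coefficient is the derivative of an inner correction coefficient plus the corresponding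
  -- outer correction coefficient.
  refine ⟨α + γ, β + δ, h1.trans ?_⟩
  module

/-- The curvature of the connection is the explicit expression in the form and the endomorphism. -/
lemma curvature [NeZero μ₀] (h : IsLocalModel A μ₀ σ Ω B D y) (hX : SmoothAt X y)
    (hY : SmoothAt Y y) (hZ : SmoothAt Z y) :
    (1 / μ₀) • (Ω y (Y y) (Z y) • B y (X y) - Ω y (X y) (Z y) • B y (Y y)
        - (2 * Ω y (X y) (Y y)) • B y (Z y)
        + Ω y (Z y) (B y (Y y)) • X y - Ω y (Z y) (B y (X y)) • Y y)
      = D.nabla X (D.nabla Y Z) y - D.nabla Y (D.nabla X Z) y - D.nabla (bracket X Y) Z y := by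
  obtain ⟨a, b, h1⟩ := h.exists_nabla_nabla X hY hZ
  obtain ⟨a', b', h2⟩ := h.exists_nabla_nabla Y hX hZ
  have h3 := h.nabla_eq.self_of_nhds (bracket X Y) Z hZ.diffAt
  have h4 := twistDeriv_comm (A := A) (μ₀ := μ₀) h.smooth (h.contMDiffAt_horDeriv hZ) hX hY
  have h5 : omega (fieldDeriv X σ y) (fieldDeriv Y σ y)
      = omega (horDeriv A μ₀ σ y (X y)) (horDeriv A μ₀ σ y (Y y)) :=
    (h.form_eq.self_of_nhds (X y) (Y y)).symm.trans (h.form.self_of_nhds _ _)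
  have h6 := h.omega_horDeriv_left.self_of_nhds
  -- The part along `σ` of the lift of `B v` is `ω`-orthogonal to horizontal vectors.
  have h7 : ∀ u v, Ω y u (B y v)
      = omega (horDeriv A μ₀ σ y u) (A.1 *ᵥ horDeriv A μ₀ σ y v) := by
    intro u v
    rw [h.form.self_of_nhds, h.endo, map_sub, map_smul, h6, smul_zero, sub_zero]
  have h8 : ∀ u v, Ω y u v = omega (horDeriv A μ₀ σ y u) (horDeriv A μ₀ σ y v) :=
    h.form.self_of_nhds
  rw [h5] at h4
  rw [sub_sub, sub_eq_iff_eq_add] at h4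
  generalize 1 / μ₀ * omega (horDeriv A μ₀ σ y (Z y))
    (A.1 *ᵥ horDeriv A μ₀ σ y (bracket X Y y)) = γ at h3
  generalize 1 / μ₀ * omega (horDeriv A μ₀ σ y (bracket X Y y)) (horDeriv A μ₀ σ y (Z y)) = δ at h3
  set ε : TangentSpace (𝓡 d) y → ℝ := fun u =>
    1 / μ₀ * omega (A.1 *ᵥ horDeriv A μ₀ σ y u) (A.1 *ᵥ σ y)
  have h9 : ∀ u, horDeriv A μ₀ σ y (B y u) = A.1 *ᵥ horDeriv A μ₀ σ y u - ε u • σ y := h.endo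
  -- The coefficients of `σ` and `Aσ` in the difference of the lifts: the `ε` terms come from the
  -- lifts of `B`, the others from the three covariant derivatives.
  apply h.eq_of_horDeriv
    (-(1 / μ₀) * (Ω y (Y y) (Z y) * ε (X y) - Ω y (X y) (Z y) * ε (Y y)
      - 2 * Ω y (X y) (Y y) * ε (Z y)) - (a - a' - γ)) (-(b - b' - δ))
  rw [map_sub, map_sub, h1, h2, h3, h4]
  simp only [map_sub, map_add, map_smul, h9, h7, h8]
  module

end IsLocalModel

end LocalModel

/-! ### Curvature tensors of Ricci type -/

section RicciTypeCurvature

variable {W : Type*} [AddCommGroup W] [Module ℝ W]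

/-- The curvature tensor determined by a symplectic form and an endomorphism. -/
def endoCurvature (Ω : W →ₗ[ℝ] W →ₗ[ℝ] ℝ) (B : W →ₗ[ℝ] W) (c : ℝ) :
    W →ₗ[ℝ] W →ₗ[ℝ] W →ₗ[ℝ] W :=
  LinearMap.mk₂ ℝ
    (fun X Y => c • ((Ω Y).smulRight (B X) - (Ω X).smulRight (B Y) - (2 * Ω X Y) • B
      + (Ω.flip (B Y)).smulRight X - (Ω.flip (B X)).smulRight Y))
    (fun X X' Y => by ext T; simp; module)
    (fun a X Y => by ext T; simp; module)
    (fun X Y Y' => by ext T; simp; module)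
    (fun a X Y => by ext T; simp; module)

lemma endoCurvature_apply (Ω : W →ₗ[ℝ] W →ₗ[ℝ] ℝ) (B : W →ₗ[ℝ] W) (c : ℝ) (X Y T : W) :
    endoCurvature Ω B c X Y T = c • (Ω Y T • B X - Ω X T • B Y - (2 * Ω X Y) • B T
      + Ω T (B Y) • X - Ω T (B X) • Y) := rfl

variable [FiniteDimensional ℝ W] {Ω : W →ₗ[ℝ] W →ₗ[ℝ] ℝ} {B : W →ₗ[ℝ] W}

/-- Infinitesimal symplectic endomorphisms are traceless. -/
lemma trace_eq_zero_of_skew (hnd : ∀ u, (∀ v, Ω u v = 0) → u = 0)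
    (hB : ∀ u v, Ω (B u) v = - Ω u (B v)) : LinearMap.trace ℝ W B = 0 := by
  have hi : Function.Injective Ω := by
    rw [← LinearMap.ker_eq_bot, LinearMap.ker_eq_bot']
    intro u hu
    exact hnd u fun v => by rw [hu]; rfl
  set e : W ≃ₗ[ℝ] Module.Dual ℝ W := LinearEquiv.ofInjectiveOfFinrankEq Ω hi
    (Subspace.dual_finrank_eq).symm
  have he : ∀ u, e u = Ω u := fun u => rfl
  -- Under the identification of `W` with its dual by `Ω`, skewness says that `B` becomes the
  -- transpose of `-B`. Its trace therefore equals its own negative.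
  have h : e.conj B = Module.Dual.transpose (R := ℝ) (-B) := by
    refine LinearMap.ext fun f => ?_
    obtain ⟨u, rfl⟩ := e.surjective f
    refine LinearMap.ext fun v => ?_
    rw [LinearEquiv.conj_apply_apply, LinearEquiv.symm_apply_apply, he]
    simp [hB, Module.Dual.transpose_apply, he]
  have h2 := LinearMap.trace_conj' B e
  rw [h, LinearMap.trace_transpose', map_neg] at h2
  linarith

/-- With `S = Ω(X, BY)`, the five terms of the tensor contribute `-S`, `0`, `-2S`, `S` and `-(dim W)
S` to the trace, up to the factor `c`; the second is zero because `tr B = 0`. -/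
lemma ricciTensor_endoCurvature (halt : ∀ u, Ω u u = 0) (hnd : ∀ u, (∀ v, Ω u v = 0) → u = 0)
    (hB : ∀ u v, Ω (B u) v = - Ω u (B v)) (c : ℝ) (X Y : W) :
    ricciTensor (endoCurvature Ω B c) X Y
      = - (c * (Module.finrank ℝ W + 2) * Ω X (B Y)) := by
  have hswap : ∀ u v, Ω u v = - Ω v u := fun u v => by
    have := halt (u + v)
    simp only [map_add, LinearMap.add_apply, halt] at this
    linarith
  have h : (endoCurvature Ω B c X).flip Y = c • ((Ω.flip Y).smulRight (B X) - Ω X Y • B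
      - (2 : ℝ) • (Ω X).smulRight (B Y) + ((Ω Y) ∘ₗ B).smulRight X
      - Ω Y (B X) • LinearMap.id) := by
    refine LinearMap.ext fun Z => ?_
    simp only [LinearMap.flip_apply, endoCurvature_apply, LinearMap.smul_apply, LinearMap.sub_apply,
      LinearMap.add_apply, LinearMap.smulRight_apply, LinearMap.comp_apply, LinearMap.id_apply]
    module
  rw [ricciTensor, h]
  simp only [map_smul, map_sub, map_add, LinearMap.trace_smulRight, LinearMap.trace_id,
    trace_eq_zero_of_skew hnd hB, smul_eq_mul, LinearMap.flip_apply, LinearMap.comp_apply]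
  rw [hB X Y, hswap Y (B X), hB X Y]
  ring

/-- The factor `dim W + 2` of the Ricci tensor cancels the normalization of `ricciPart`, and the
rest is the symmetry of `Ω(·, B·)`. -/
lemma isRicciType_endoCurvature (halt : ∀ u, Ω u u = 0) (hnd : ∀ u, (∀ v, Ω u v = 0) → u = 0)
    (hB : ∀ u v, Ω (B u) v = - Ω u (B v)) (c : ℝ) :
    IsRicciType Ω (endoCurvature Ω B c) := by
  intro X Y Z T
  have hd : (Module.finrank ℝ W + 2 : ℝ) ≠ 0 := by positivity
  have hsymm : ∀ u v, Ω u (B v) = Ω v (B u) := fun u v => by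
    have := halt (u + B v)
    simp only [map_add, LinearMap.add_apply, halt] at this
    linarith [hB v u]
  rw [weylPart, ricciPart]
  simp only [ricciTensor_endoCurvature halt hnd hB, endoCurvature_apply, map_smul, map_sub, map_add,
    LinearMap.smul_apply, LinearMap.sub_apply, LinearMap.add_apply, smul_eq_mul, hB,
    hsymm Z Y, hsymm Z X]
  field_simp
  ring

end RicciTypeCurvature

/-! ### The quadric as an embedded submanifold -/

section Embedding

open Filter Topology

variable {A : Sp n} {μ₀ : ℝ} [NeZero μ₀]

/-- The chart at `x` is the restriction of a linear map. -/
def chartCLM (x : Quadric A μ₀) : Phase n →L[ℝ] EuclideanSpace ℝ (Fin (2 * n + 1)) :=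
  (kerEquiv x).toContinuousLinearMap ∘L LinearMap.toContinuousLinearMap (kerProj x)

/-! ### Maps into the quadric -/

section Maps

variable {E H N : Type*} [NormedAddCommGroup E] [NormedSpace ℝ E] [TopologicalSpace H]
  {I : ModelWithCorners ℝ E H} [TopologicalSpace N] [ChartedSpace H N]

/-- Differentiability of maps to the quadric is tested in the ambient space. -/
lemma mdifferentiableAt_quadric {f : N → Quadric A μ₀} {p : N}
    (hf : MDifferentiableAt I 𝓘(ℝ, Phase n) (fun q => (f q).1) p) :
    MDifferentiableAt I (𝓡 (2 * n + 1)) f p := by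
  refine mdifferentiableAt_iff_target.2
    ⟨Topology.IsInducing.subtypeVal.continuousAt_iff.2 hf.continuousAt, ?_⟩
  exact (chartCLM (f p)).differentiable.mdifferentiable.mdifferentiableAt.comp p hf

lemma incl_mfderiv {f : N → Quadric A μ₀} {p : N} {x : Quadric A μ₀} (hx : f p = x)
    (hf : MDifferentiableAt I (𝓡 (2 * n + 1)) f p) (v : TangentSpace I p) :
    incl A μ₀ x (mfderiv I (𝓡 (2 * n + 1)) f p v) = mvfderiv I (fun q => (f q).1) p v := by
  subst hx
  exact (mfderiv_comp_apply p (contMDiff_coe.mdifferentiableAt (by simp)) hf v).symm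

end Maps

/-- The composite of the inclusion with this linear map is the chart at `x`, whose differential at
its own base point is the identity. Injectivity of the differential of the inclusion follows. -/
lemma chartCLM_incl (x : Quadric A μ₀) (v : TangentSpace (𝓡 (2 * n + 1)) x) :
    chartCLM x (incl A μ₀ x v) = v := by
  have h := mvfderiv_clm (chartCLM x)
    (contMDiff_coe.mdifferentiableAt (x := x) (by simp)) v
  refine h.symm.trans ?_
  exact congrArg (fun L => L v) (mfderiv_extChartAt_self (I := 𝓡 (2 * n + 1)) (x := x))

lemma incl_injective (x : Quadric A μ₀) : Function.Injective (incl A μ₀ x) := by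
  intro v w h
  exact (chartCLM_incl x v).symm.trans ((congrArg (chartCLM x) h).trans (chartCLM_incl x w))

lemma omega_incl_mulVec (x : Quadric A μ₀) (v : TangentSpace (𝓡 (2 * n + 1)) x) :
    omega (incl A μ₀ x v) (A.1 *ᵥ x.1) = 0 := by
  have hc : MDifferentiableAt (𝓡 (2 * n + 1)) 𝓘(ℝ, Phase n) (Subtype.val : Quadric A μ₀ → Phase n)
    x :=
    contMDiff_coe.mdifferentiableAt (by simp)
  exact omega_mvfderiv_mulVec (Eventually.of_forall fun q => q.2) hc v

/-- The tangent space embeds in the hyperplane `(Ax)^⊥`, and both have dimension `2n+1`. -/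
lemma exists_incl_eq (x : Quadric A μ₀) {w : Phase n} (hw : omega w (A.1 *ᵥ x.1) = 0) :
    ∃ v, incl A μ₀ x v = w := by
  have hi : LinearMap.range (incl A μ₀ x).toLinearMap = LinearMap.ker (ell A x.1) := by
    refine Submodule.eq_of_le_of_finrank_eq ?_ ?_
    · rintro _ ⟨v, rfl⟩
      exact omega_incl_mulVec x v
    · rw [finrank_ker_ell]
      exact LinearMap.finrank_range_of_inj (incl_injective x)
  have : w ∈ LinearMap.range (incl A μ₀ x).toLinearMap := hi ▸ hw
  exact this

end Embedding

/-! ### The flow -/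

section Flow

open Filter Topology

/-- The flow at time `t` as a continuous linear map. -/
def flowCLM (A : Sp n) (t : ℝ) : Phase n →L[ℝ] Phase n :=
  LinearMap.toContinuousLinearMap (Matrix.toLin' (NormedSpace.exp (t • ((-2 : ℝ) • A.1))))

lemma flowCLM_apply (A : Sp n) (t : ℝ) (x : Phase n) : flowCLM A t x = flow A t x := by
  simp [flowCLM, flow]

lemma mulVec_flow (A : Sp n) (t : ℝ) (x : Phase n) :
    A.1 *ᵥ flow A t x = flow A t (A.1 *ᵥ x) := by
  let _ := Matrix.linftyOpNormedRing (n := Fin (n + 1) ⊕ Fin (n + 1)) (α := ℝ)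
  let _ := Matrix.linftyOpNormedAlgebra (R := ℝ) (n := Fin (n + 1) ⊕ Fin (n + 1)) (α := ℝ)
  rw [flow, flow, Matrix.mulVec_mulVec, Matrix.mulVec_mulVec]
  have h : Commute A.1 (t • ((-2 : ℝ) • A.1)) :=
    ((Commute.refl A.1).smul_right _).smul_right _
  exact congrArg (fun C => C *ᵥ x) h.exp_right

/-- The derivative in `t` is `-2 (ω(Ax_t, y_t) + ω(x_t, Ay_t)) = 0`. -/
lemma omega_flow (A : Sp n) (t : ℝ) (x y : Phase n) :
    omega (flow A t x) (flow A t y) = omega x y := by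
  have h : ∀ s, HasDerivAt (fun s => omega (flow A s x) (flow A s y)) 0 s := by
    intro s
    have h1 := omegaCLM.hasFDerivAt_of_bilinear (hasDerivAt_flow A x s).hasFDerivAt
      (hasDerivAt_flow A y s).hasFDerivAt
    have h2 := h1.hasDerivAt
    refine h2.congr_deriv ?_
    simp [omegaCLM_apply, omega_mulVec_left]
  have h2 := is_const_of_deriv_eq_zero (fun s => (h s).differentiableAt) (fun s => (h s).deriv) t 0
  simpa [flow_zero] using h2

lemma ham_flow (A : Sp n) (t : ℝ) (x : Phase n) : ham A (flow A t x) = ham A x := by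
  rw [ham, mulVec_flow, omega_flow, ham]

variable {A : Sp n} {μ₀ : ℝ}

/-- The flow on the quadric. -/
def quadricFlow (t : ℝ) (x : Quadric A μ₀) : Quadric A μ₀ :=
  ⟨flow A t x.1, (ham_flow A t x.1).trans x.2⟩

lemma proj_quadricFlow (t : ℝ) (x : Quadric A μ₀) : proj A μ₀ (quadricFlow t x) = proj A μ₀ x :=
  Eq.symm (Quotient.sound ⟨t, rfl⟩)

lemma exists_quadricFlow_eq {x x' : Quadric A μ₀} (h : proj A μ₀ x = proj A μ₀ x') :
    ∃ t, quadricFlow t x = x' := by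
  obtain ⟨t, ht⟩ := Quotient.exact h
  exact ⟨t, Subtype.ext ht⟩

lemma proj_surjective : Function.Surjective (proj A μ₀) := Quotient.mk_surjective

variable {d : ℕ} {M : Type*} [TopologicalSpace M] [ChartedSpace (EuclideanSpace ℝ (Fin d)) M]

lemma horDeriv_flow {σ : M → Phase n} {p : M} (hσ : MDifferentiableAt (𝓡 d) 𝓘(ℝ, Phase n) σ p)
    (t : ℝ) (v : TangentSpace (𝓡 d) p) :
    horDeriv A μ₀ (fun q => flow A t (σ q)) p v = flow A t (horDeriv A μ₀ σ p v) := by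
  have h : mvfderiv (𝓡 d) (fun q => flow A t (σ q)) p v = flow A t (mvfderiv (𝓡 d) σ p v) := by
    simp only [← flowCLM_apply]
    exact mvfderiv_clm _ hσ v
  simp only [horDeriv_apply, vertCoeff_apply, h, omega_flow, mulVec_flow]
  simp only [← flowCLM_apply, map_add, map_smul]

variable [NeZero μ₀]

/-- The tangent vector to the quadric represented by `Ax`. -/
lemma exists_incl_eq_mulVec (x : Quadric A μ₀) : ∃ v, incl A μ₀ x v = A.1 *ᵥ x.1 :=
  exists_incl_eq x (omega_self _)

/-- Any curve with the right velocity in the ambient space computes the derivative. This is used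
along orbits, where `π` is constant and lifted fields are transported by the flow. -/
lemma mfderiv_curve {E H N : Type*} [NormedAddCommGroup E] [NormedSpace ℝ E] [TopologicalSpace H]
    {I : ModelWithCorners ℝ E H} [TopologicalSpace N] [ChartedSpace H N]
    {f : Quadric A μ₀ → N} {c : ℝ → Quadric A μ₀} {x : Quadric A μ₀} (hx : c 0 = x)
    (hf : MDifferentiableAt (𝓡 (2 * n + 1)) I f x) {v : TangentSpace (𝓡 (2 * n + 1)) x}
    (hc : HasDerivAt (fun t => (c t).1) (incl A μ₀ x v) 0) :
    (mfderiv (𝓡 (2 * n + 1)) I f x v : E) = mfderiv 𝓘(ℝ, ℝ) I (f ∘ c) 0 (1 : ℝ) := by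
  subst hx
  have hd : MDifferentiableAt 𝓘(ℝ, ℝ) (𝓡 (2 * n + 1)) c 0 :=
    mdifferentiableAt_quadric hc.differentiableAt.mdifferentiableAt
  have h1 : mfderiv 𝓘(ℝ, ℝ) (𝓡 (2 * n + 1)) c 0 (1 : ℝ) = v := by
    apply incl_injective
    refine (incl_mfderiv rfl hd _).trans ?_
    refine (congrArg (fun L => L (1 : ℝ)) (mfderiv_eq_fderiv (𝕜 := ℝ)
      (f := fun t => (c t).1) (x := (0 : ℝ)))).trans ?_
    exact hc.deriv
  have h2 := mfderiv_comp_apply (0 : ℝ) hf hd (1 : ℝ)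
  rw [h1] at h2
  exact h2.symm

/-- The orbit of `x`, parametrized with velocity `Ax`. -/
lemma hasDerivAt_orbit (A : Sp n) (x : Phase n) :
    HasDerivAt (fun t => flow A (-(1 / 2) * t) x) (A.1 *ᵥ x) 0 := by
  have h1 : HasDerivAt (fun t : ℝ => -(1 / 2) * t) (-(1 / 2)) 0 := by
    simpa using (hasDerivAt_id (0 : ℝ)).const_mul (-(1 / 2) : ℝ)
  refine ((hasDerivAt_flow A x _).scomp (0 : ℝ) h1).congr_deriv ?_
  simp [flow_zero, smul_smul]

omit [NeZero μ₀] in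
lemma quadricFlow_zero (x : Quadric A μ₀) : quadricFlow 0 x = x := Subtype.ext (flow_zero A x.1)

lemma mvfderiv_eq_of_flow {F : Type*} [NormedAddCommGroup F] [NormedSpace ℝ F]
    {f : Quadric A μ₀ → F} {x : Quadric A μ₀} {w : F}
    (hf : MDifferentiableAt (𝓡 (2 * n + 1)) 𝓘(ℝ, F) f x) {v : TangentSpace (𝓡 (2 * n + 1)) x}
    (hv : incl A μ₀ x v = A.1 *ᵥ x.1)
    (hw : HasDerivAt (fun t => f (quadricFlow (-(1 / 2) * t) x)) w 0) :
    mvfderiv (𝓡 (2 * n + 1)) f x v = w := by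
  have h1 := mfderiv_curve (c := fun t => quadricFlow (-(1 / 2) * t) x) (x := x)
    (by simp [quadricFlow_zero]) hf (v := v) (by rw [hv]; exact hasDerivAt_orbit A x.1)
  refine h1.trans ((congrArg (fun L => L (1 : ℝ)) (mfderiv_eq_fderiv (𝕜 := ℝ)
      (f := fun t => f (quadricFlow (-(1 / 2) * t) x)) (x := (0 : ℝ)))).trans ?_)
  exact hw.deriv

variable [ChartedSpace (EuclideanSpace ℝ (Fin (2 * n))) (Reduced A μ₀)]

lemma dproj_eq_zero {x : Quadric A μ₀}
    (hπ : MDifferentiableAt (𝓡 (2 * n + 1)) (𝓡 (2 * n)) (proj A μ₀) x)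
    {v : TangentSpace (𝓡 (2 * n + 1)) x} (hv : incl A μ₀ x v = A.1 *ᵥ x.1) :
    dproj A μ₀ x v = 0 := by
  have h1 := mfderiv_curve (c := fun t => quadricFlow (-(1 / 2) * t) x) (x := x)
    (by simp [quadricFlow_zero]) hπ (v := v) (by rw [hv]; exact hasDerivAt_orbit A x.1)
  have h2 : (proj A μ₀ ∘ fun t => quadricFlow (-(1 / 2) * t) x) = fun _ => proj A μ₀ x := by
    funext t
    exact proj_quadricFlow _ _
  rw [h2, mfderiv_const] at h1
  exact h1

end Flow

/-! ### Local sections of the projection -/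

section Sections

open Filter Topology

variable {A : Sp n} {μ₀ : ℝ} [NeZero μ₀]
  [ChartedSpace (EuclideanSpace ℝ (Fin (2 * n))) (Reduced A μ₀)]

/-- `s` is a differentiable local section of the projection near `y`. -/
structure IsLocalSection (s : Reduced A μ₀ → Quadric A μ₀) (y : Reduced A μ₀) : Prop where
  eventually_mdifferentiableAt : ∀ᶠ q in 𝓝 y,
    MDifferentiableAt (𝓡 (2 * n)) 𝓘(ℝ, Phase n) (fun q => (s q).1) q
  proj_eq : ∀ᶠ q in 𝓝 y, proj A μ₀ (s q) = q

namespace IsLocalSection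

variable {s : Reduced A μ₀ → Quadric A μ₀} {y : Reduced A μ₀}

omit [NeZero μ₀] in
lemma of_contMDiffAt [IsManifold (𝓡 (2 * n)) ∞ (Reduced A μ₀)]
    (hs : ContMDiffAt (𝓡 (2 * n)) 𝓘(ℝ, Phase n) ∞ (fun q => (s q).1) y)
    (h : ∀ᶠ q in 𝓝 y, proj A μ₀ (s q) = q) : IsLocalSection s y :=
  ⟨SymplecticReduction.eventually_mdifferentiableAt hs, h⟩

omit [NeZero μ₀] in
lemma mdifferentiableAt_coe (hs : IsLocalSection s y) :
    MDifferentiableAt (𝓡 (2 * n)) 𝓘(ℝ, Phase n) (fun q => (s q).1) y :=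
  hs.eventually_mdifferentiableAt.self_of_nhds

lemma mdifferentiableAt (hs : IsLocalSection s y) :
    MDifferentiableAt (𝓡 (2 * n)) (𝓡 (2 * n + 1)) s y :=
  mdifferentiableAt_quadric hs.mdifferentiableAt_coe

omit [NeZero μ₀] in
lemma quadricFlow (hs : IsLocalSection s y) (t : ℝ) :
    IsLocalSection (fun q => quadricFlow t (s q)) y where
  eventually_mdifferentiableAt := by
    filter_upwards [hs.eventually_mdifferentiableAt] with p hp
    have : (fun q => (SymplecticReduction.quadricFlow t (s q)).1)
        = fun q => flowCLM A t (s q).1 := by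
      funext q
      exact (flowCLM_apply A t _).symm
    rw [this]
    exact (flowCLM A t).differentiable.mdifferentiable.mdifferentiableAt.comp p hp
  proj_eq := hs.proj_eq.mono fun q hq => (proj_quadricFlow t _).trans hq

omit [NeZero μ₀] in
lemma eventually (hs : IsLocalSection s y) : ∀ᶠ q in 𝓝 y, IsLocalSection s q := by
  filter_upwards [eventually_eventually_nhds.2 hs.eventually_mdifferentiableAt,
    eventually_eventually_nhds.2 hs.proj_eq] with q h1 h2 using ⟨h1, h2⟩

lemma dproj_mfderiv (hs : IsLocalSection s y) {x : Quadric A μ₀} (hx : s y = x)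
    (hπ : MDifferentiableAt (𝓡 (2 * n + 1)) (𝓡 (2 * n)) (proj A μ₀) x)
    (v : TangentSpace (𝓡 (2 * n)) y) :
    (dproj A μ₀ x (mfderiv (𝓡 (2 * n)) (𝓡 (2 * n + 1)) s y v) : EuclideanSpace ℝ (Fin (2 * n)))
      = v := by
  subst hx
  have h1 := mfderiv_comp_apply y hπ hs.mdifferentiableAt v
  have h2 : (proj A μ₀ ∘ s) =ᶠ[𝓝 y] id := hs.proj_eq
  rw [h2.mfderiv_eq, mfderiv_id] at h1
  exact h1.symm

end IsLocalSection

/-- A submersion has a family of local sections, one through each point near a given one, which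
depends smoothly on that point. -/
lemma exists_family_sections [IsManifold (𝓡 (2 * n)) ∞ (Reduced A μ₀)]
    (hπ : Manifold.IsSubmersion (𝓡 (2 * n + 1)) (𝓡 (2 * n)) ∞ (proj A μ₀)) (x : Quadric A μ₀) :
    ∃ (φ : Quadric A μ₀ → EuclideanSpace ℝ (Fin (2 * n + 1)))
      (ψ : Reduced A μ₀ → EuclideanSpace ℝ (Fin (2 * n)))
      (g : EuclideanSpace ℝ (Fin (2 * n + 1)) → Quadric A μ₀)
      (L : EuclideanSpace ℝ (Fin (2 * n)) →L[ℝ] EuclideanSpace ℝ (Fin (2 * n + 1))),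
      ContMDiffAt (𝓡 (2 * n + 1)) 𝓘(ℝ, EuclideanSpace ℝ (Fin (2 * n + 1))) ∞ φ x ∧
      ContMDiffAt (𝓡 (2 * n)) 𝓘(ℝ, EuclideanSpace ℝ (Fin (2 * n))) ∞ ψ (proj A μ₀ x) ∧
      ContDiffAt ℝ ∞ (fun u => (g u).1) (φ x) ∧
      ∀ᶠ p in 𝓝 x, g (φ p) = p ∧
        ContMDiffAt (𝓡 (2 * n)) 𝓘(ℝ, Phase n) ∞
          (fun q => (g (φ p + L (ψ q - ψ (proj A μ₀ p)))).1) (proj A μ₀ p) ∧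
        IsLocalSection (fun q => g (φ p + L (ψ q - ψ (proj A μ₀ p)))) (proj A μ₀ p) := by
  have h := hπ.isSubmersionAt x
  set φ := h.domChart with hφ
  set ψ := h.codChart with hψ
  set e := h.equiv with he
  have hm : ∀ p ∈ φ.source, proj A μ₀ p ∈ ψ.source := fun p hp =>
    h.source_subset_preimage_source hp
  -- In submersion charts `π` is the projection to the first factor.
  have hw : ∀ p ∈ φ.source, ψ (proj A μ₀ p) = (e (φ p)).1 := by
    intro p hp
    have h1 : φ p ∈ (φ.extend (𝓡 (2 * n + 1))).target := by
      simpa using φ.map_source hp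
    have h2 := h.writtenInCharts h1
    simp only [← hφ, ← hψ, ← he] at h2
    simpa [φ.left_inv hp] using h2
  -- `L` is the inclusion of the base coordinates. The section through `p` keeps the fibre
  -- coordinate of `p` and moves only the base coordinates.
  set L : EuclideanSpace ℝ (Fin (2 * n)) →L[ℝ] EuclideanSpace ℝ (Fin (2 * n + 1)) :=
    e.symm.toContinuousLinearMap ∘L ContinuousLinearMap.inl ℝ _ _ with hL
  have hψs : ∀ q ∈ ψ.source,
      ContMDiffAt (𝓡 (2 * n)) 𝓘(ℝ, EuclideanSpace ℝ (Fin (2 * n))) ∞ ψ q := fun q hq =>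
    contMDiffAt_of_mem_maximalAtlas h.codChart_mem_maximalAtlas hq
  have hφs : ∀ p ∈ φ.source,
      ContMDiffAt (𝓡 (2 * n + 1)) 𝓘(ℝ, EuclideanSpace ℝ (Fin (2 * n + 1))) ∞ φ p := fun q hq =>
    contMDiffAt_of_mem_maximalAtlas h.domChart_mem_maximalAtlas hq
  have hg : ∀ p ∈ φ.source, ContDiffAt ℝ ∞ (fun u => (φ.symm u).1) (φ p) := by
    intro p hp
    rw [← contMDiffAt_iff_contDiffAt]
    exact contMDiff_coe.contMDiffAt.comp (φ p)
      (contMDiffAt_symm_of_mem_maximalAtlas h.domChart_mem_maximalAtlas (φ.map_source hp))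
  refine ⟨φ, ψ, φ.symm, L, hφs x h.mem_domChart_source, hψs _ h.mem_codChart_source,
    hg x h.mem_domChart_source, ?_⟩
  filter_upwards [φ.open_source.mem_nhds h.mem_domChart_source] with p hp
  have hc : ContMDiffAt (𝓡 (2 * n)) 𝓘(ℝ, EuclideanSpace ℝ (Fin (2 * n + 1))) ∞
      (fun q => φ p + L (ψ q - ψ (proj A μ₀ p))) (proj A μ₀ p) :=
    contMDiffAt_const.add (L.contDiff.contMDiff.contMDiffAt.comp _
      ((hψs _ (hm p hp)).sub contMDiffAt_const))
  have h0 : φ p + L (ψ (proj A μ₀ p) - ψ (proj A μ₀ p)) = φ p := by simp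
  have hs : ContMDiffAt (𝓡 (2 * n)) 𝓘(ℝ, Phase n) ∞
          (fun q => (φ.symm (φ p + L (ψ q - ψ (proj A μ₀ p)))).1) (proj A μ₀ p) := by
    refine ContMDiffAt.comp (g := fun u => (φ.symm u).1) (proj A μ₀ p) ?_ hc
    rw [h0]
    exact (hg p hp).contMDiffAt
  refine ⟨φ.left_inv hp, hs, .of_contMDiffAt hs ?_⟩
  have ht : ∀ᶠ q in 𝓝 (proj A μ₀ p), φ p + L (ψ q - ψ (proj A μ₀ p)) ∈ φ.target := by
    refine (ContMDiffAt.continuousAt hc) (φ.open_target.mem_nhds ?_)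
    beta_reduce
    rw [h0]
    exact φ.map_source hp
  filter_upwards [ht, ψ.open_source.mem_nhds (hm p hp)] with q hq hq2
  have hq3 := φ.map_target hq
  refine ψ.injOn (hm _ hq3) hq2 ?_
  rw [hw _ hq3, φ.right_inv hq, map_add, Prod.fst_add, ← hw p hp]
  simp [hL]

lemma exists_section [IsManifold (𝓡 (2 * n)) ∞ (Reduced A μ₀)]
    (hπ : Manifold.IsSubmersion (𝓡 (2 * n + 1)) (𝓡 (2 * n)) ∞ (proj A μ₀)) (x : Quadric A μ₀) :
    ∃ s, ContMDiffAt (𝓡 (2 * n)) 𝓘(ℝ, Phase n) ∞ (fun q => (s q).1) (proj A μ₀ x) ∧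
      IsLocalSection s (proj A μ₀ x) ∧ s (proj A μ₀ x) = x := by
  obtain ⟨φ, ψ, g, L, -, -, -, h⟩ := exists_family_sections hπ x
  obtain ⟨h1, h2, h3⟩ := h.self_of_nhds
  exact ⟨_, h2, h3, by simpa using h1⟩

end Sections

/-! ### Horizontal lifts in terms of local sections -/

section HorizontalLifts

open Filter Topology

variable {A : Sp n} {μ₀ : ℝ} [NeZero μ₀]
  [ChartedSpace (EuclideanSpace ℝ (Fin (2 * n))) (Reduced A μ₀)]
  [IsManifold (𝓡 (2 * n)) ∞ (Reduced A μ₀)]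

/-- The derivative at `π(x)` of a local section through `x`. -/
def sectionDeriv (s : Reduced A μ₀ → Quadric A μ₀) (x : Quadric A μ₀) :
    TangentSpace (𝓡 (2 * n)) (proj A μ₀ x) →L[ℝ] TangentSpace (𝓡 (2 * n + 1)) x :=
  (mfderiv (𝓡 (2 * n)) (𝓡 (2 * n + 1)) s (proj A μ₀ x) :)

omit [IsManifold (𝓡 (2 * n)) ∞ (Reduced A μ₀)] in
lemma mdifferentiableAt_proj
    (hπ : Manifold.IsSubmersion (𝓡 (2 * n + 1)) (𝓡 (2 * n)) ∞ (proj A μ₀)) (x : Quadric A μ₀) :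
    MDifferentiableAt (𝓡 (2 * n + 1)) (𝓡 (2 * n)) (proj A μ₀) x :=
  ContMDiffAt.mdifferentiableAt hπ.contMDiff.contMDiffAt (by simp)

variable (hπ : Manifold.IsSubmersion (𝓡 (2 * n + 1)) (𝓡 (2 * n)) ∞ (proj A μ₀))
include hπ

lemma dproj_surjective (x : Quadric A μ₀) : Function.Surjective (dproj A μ₀ x) := by
  intro u
  obtain ⟨s, -, hs, hx⟩ := exists_section hπ x
  exact ⟨_, hs.dproj_mfderiv hx (mdifferentiableAt_proj hπ x) u⟩

/-- The kernel of `π_*` has dimension `(2n+1) - 2n = 1` and contains `Ax`, which is nonzero because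
`H(x) = μ₀ ≠ 0`. -/
lemma eq_smul_of_dproj_eq_zero {x : Quadric A μ₀} {v w : TangentSpace (𝓡 (2 * n + 1)) x}
    (hv : incl A μ₀ x v = A.1 *ᵥ x.1) (hw : dproj A μ₀ x w = 0) : ∃ c : ℝ, c • v = w := by
  have : FiniteDimensional ℝ (TangentSpace (𝓡 (2 * n + 1)) x) :=
    inferInstanceAs (FiniteDimensional ℝ (EuclideanSpace ℝ (Fin (2 * n + 1))))
  have h1 : Module.finrank ℝ (LinearMap.ker (dproj A μ₀ x).toLinearMap) = 1 := by
    have h := LinearMap.finrank_range_add_finrank_ker (dproj A μ₀ x).toLinearMap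
    rw [LinearMap.range_eq_top.2 (dproj_surjective hπ x), finrank_top] at h
    have h2 : Module.finrank ℝ (TangentSpace (𝓡 (2 * n + 1)) x) = 2 * n + 1 :=
      finrank_euclideanSpace_fin
    have h3 : Module.finrank ℝ (TangentSpace (𝓡 (2 * n)) (proj A μ₀ x)) = 2 * n :=
      finrank_euclideanSpace_fin
    omega
  have h0 : v ≠ 0 := by
    rintro rfl
    have h2 := x.2
    rw [ham, ← hv, map_zero, map_zero] at h2
    exact NeZero.ne μ₀ h2.symm
  obtain ⟨c, hc⟩ := (finrank_eq_one_iff_of_nonzero'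
    (⟨v, dproj_eq_zero (mdifferentiableAt_proj hπ x) hv⟩ :
      LinearMap.ker (dproj A μ₀ x).toLinearMap) (fun h => h0 (congrArg Subtype.val h))).1 h1 ⟨w, hw⟩
  exact ⟨c, congrArg Subtype.val hc⟩

omit [IsManifold (𝓡 (2 * n)) ∞ (Reduced A μ₀)] in
/-- The horizontal representative, in terms of a local section, of a tangent vector of `M`. -/
lemma exists_horizontal_eq {x : Quadric A μ₀} {s : Reduced A μ₀ → Quadric A μ₀}
    (hs : IsLocalSection s (proj A μ₀ x)) (hx : s (proj A μ₀ x) = x)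
    {v : TangentSpace (𝓡 (2 * n + 1)) x} (hv : incl A μ₀ x v = A.1 *ᵥ x.1)
    (u : TangentSpace (𝓡 (2 * n)) (proj A μ₀ x)) :
    ∃ w ∈ horizontal A μ₀ x, dproj A μ₀ x w = u ∧
      w = sectionDeriv s x u + vertCoeff μ₀ (fun q => (s q).1) (proj A μ₀ x) u • v ∧
      incl A μ₀ x w = horDeriv A μ₀ (fun q => (s q).1) (proj A μ₀ x) u := by
  set ds := sectionDeriv s x u
  set c := vertCoeff μ₀ (fun q => (s q).1) (proj A μ₀ x) u with hc
  have h1 : incl A μ₀ x ds = mvfderiv (𝓡 (2 * n)) (fun q => (s q).1) (proj A μ₀ x) u :=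
    incl_mfderiv hx hs.mdifferentiableAt u
  have h2 : incl A μ₀ x (ds + c • v) = horDeriv A μ₀ (fun q => (s q).1) (proj A μ₀ x) u := by
    rw [map_add, map_smul, h1, hv, horDeriv_apply, hx]
  refine ⟨ds + c • v, ⟨?_, ?_⟩, ?_, rfl, h2⟩
  · rw [h2]
    have := omega_horDeriv_self (A := A) (μ₀ := μ₀) (σ := fun q => (s q).1) (s (proj A μ₀ x)).2 u
    rwa [hx] at this
  · exact omega_incl_mulVec x _
  · rw [map_add, map_smul, dproj_eq_zero (mdifferentiableAt_proj hπ x) hv, smul_zero, add_zero]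
    exact hs.dproj_mfderiv hx (mdifferentiableAt_proj hπ x) u

/-- A vertical vector `c Ax` is horizontal only if `ω(c Ax, x) = -c μ₀` vanishes, which gives
injectivity. For surjectivity, the derivative of a section is made horizontal by a vertical
correction. -/
lemma dproj_horizontal_bijective (x : Quadric A μ₀) :
    Function.Bijective (dproj A μ₀ x ∘L (horizontal A μ₀ x).subtypeL) := by
  obtain ⟨v, hv⟩ := exists_incl_eq_mulVec x
  constructor
  · refine (injective_iff_map_eq_zero _).2 ?_
    rintro ⟨w, hw⟩ h
    obtain ⟨c, rfl⟩ := eq_smul_of_dproj_eq_zero hπ hv h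
    have h1 := hw.1
    rw [map_smul, hv, map_smul, LinearMap.smul_apply, omega_mulVec_left] at h1
    have h2 : omega x.1 (A.1 *ᵥ x.1) = μ₀ := x.2
    rw [h2] at h1
    have h3 : c = 0 := by simpa [NeZero.ne μ₀] using h1
    apply Subtype.ext
    simp [h3]
  · intro u
    obtain ⟨s, -, hs, hx⟩ := exists_section hπ x
    obtain ⟨w, hw, h, -⟩ := exists_horizontal_eq hπ hs hx hv u
    exact ⟨⟨w, hw⟩, h⟩

lemma lift_dproj {x : Quadric A μ₀} {w : TangentSpace (𝓡 (2 * n + 1)) x}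
    (hw : w ∈ horizontal A μ₀ x) : lift A μ₀ x (dproj A μ₀ x w) = w := by
  -- `ContinuousLinearMap.inverse` takes a default value off the invertible maps, so the bijection
  -- must be recognized as a continuous linear equivalence.
  let e := LinearEquiv.ofBijective (dproj A μ₀ x ∘L (horizontal A μ₀ x).subtypeL).toLinearMap
    (dproj_horizontal_bijective hπ x)
  have : FiniteDimensional ℝ (TangentSpace (𝓡 (2 * n + 1)) x) :=
    inferInstanceAs (FiniteDimensional ℝ (EuclideanSpace ℝ (Fin (2 * n + 1))))
  have : T2Space (TangentSpace (𝓡 (2 * n + 1)) x) :=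
    inferInstanceAs (T2Space (EuclideanSpace ℝ (Fin (2 * n + 1))))
  have : T2Space (TangentSpace (𝓡 (2 * n)) (proj A μ₀ x)) :=
    inferInstanceAs (T2Space (EuclideanSpace ℝ (Fin (2 * n))))
  let e' := e.toContinuousLinearEquiv
  have he : (dproj A μ₀ x ∘L (horizontal A μ₀ x).subtypeL) = e' := by
    ext1 v; rfl
  have h1 : lift A μ₀ x (dproj A μ₀ x w) = (e'.symm (dproj A μ₀ x w)).1 := by
    rw [lift, he, ContinuousLinearMap.inverse_equiv]
    rfl
  have h2 : dproj A μ₀ x w = e' ⟨w, hw⟩ := rfl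
  rw [h1, h2, e'.symm_apply_apply]

/-- The right-hand side is horizontal and projects to `u`, which characterizes the lift. In
particular it depends only on the point `x` and not on the section. -/
lemma hlift_eq_horDeriv {x : Quadric A μ₀} {s : Reduced A μ₀ → Quadric A μ₀}
    (hs : IsLocalSection s (proj A μ₀ x)) (hx : s (proj A μ₀ x) = x)
    (u : TangentSpace (𝓡 (2 * n)) (proj A μ₀ x)) :
    hlift A μ₀ x u = horDeriv A μ₀ (fun q => (s q).1) (proj A μ₀ x) u := by
  obtain ⟨v, hv⟩ := exists_incl_eq_mulVec x
  obtain ⟨w, hw, h, -, hi⟩ := exists_horizontal_eq hπ hs hx hv u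
  rw [← hi, ← h]
  exact congrArg _ (lift_dproj hπ hw)

lemma lift_eq {x : Quadric A μ₀} {s : Reduced A μ₀ → Quadric A μ₀}
    (hs : IsLocalSection s (proj A μ₀ x)) (hx : s (proj A μ₀ x) = x)
    {v : TangentSpace (𝓡 (2 * n + 1)) x} (hv : incl A μ₀ x v = A.1 *ᵥ x.1)
    (u : TangentSpace (𝓡 (2 * n)) (proj A μ₀ x)) :
    lift A μ₀ x u = sectionDeriv s x u + vertCoeff μ₀ (fun q => (s q).1) (proj A μ₀ x) u • v := by
  obtain ⟨w, hw, h, hi, -⟩ := exists_horizontal_eq hπ hs hx hv u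
  rw [← h]
  refine (lift_dproj hπ hw).trans ?_
  rw [h]
  exact hi

lemma dproj_lift (x : Quadric A μ₀) (u : TangentSpace (𝓡 (2 * n)) (proj A μ₀ x)) :
    dproj A μ₀ x (lift A μ₀ x u) = u := by
  obtain ⟨⟨w, hw⟩, rfl⟩ := (dproj_horizontal_bijective hπ x).2 u
  exact congrArg _ (lift_dproj hπ hw)

lemma hlift_injective (x : Quadric A μ₀) : Function.Injective (hlift A μ₀ x) := by
  intro u u' h
  rw [← dproj_lift hπ x u, ← dproj_lift hπ x u']
  exact congrArg _ (incl_injective x h)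

/-- The horizontal vectors of the ambient space are the horizontal lifts. -/
lemma exists_hlift_eq (x : Quadric A μ₀) {w : Phase n} (h1 : omega w x.1 = 0)
    (h2 : omega w (A.1 *ᵥ x.1) = 0) : ∃ u, hlift A μ₀ x u = w := by
  obtain ⟨v, rfl⟩ := exists_incl_eq x h2
  exact ⟨dproj A μ₀ x v, congrArg _ (lift_dproj hπ ⟨h1, h2⟩)⟩

end HorizontalLifts

/-! ### The connection in terms of local sections -/

section ConnectionLift

open Filter Topology

/-! ### The lifted connection formula for a map into phase space -/

section General

variable {d : ℕ} {M : Type*} [TopologicalSpace M] [ChartedSpace (EuclideanSpace ℝ (Fin d)) M]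

/-- The horizontal representative of `∇_u Z` in terms of a local section `σ`. -/
def connLift (A : Sp n) (μ₀ : ℝ) (σ : M → Phase n) (Z : VField d M) (p : M)
    (u : TangentSpace (𝓡 d) p) : Phase n :=
  mvfderiv (𝓡 d) (fun q => horDeriv A μ₀ σ q (Z q)) p u
      + vertCoeff μ₀ σ p u • (A.1 *ᵥ horDeriv A μ₀ σ p (Z p))
      + (1 / μ₀ * omega (horDeriv A μ₀ σ p (Z p)) (A.1 *ᵥ horDeriv A μ₀ σ p u)) • σ p
      + (1 / μ₀ * omega (horDeriv A μ₀ σ p u) (horDeriv A μ₀ σ p (Z p))) • (A.1 *ᵥ σ p)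

variable {A : Sp n} {μ₀ : ℝ} {σ : M → Phase n} {Z : VField d M} {p : M}

/-- For fixed `t` the flow is a linear map that preserves `ω` and commutes with `A`, and the formula
is built from these data only. -/
lemma connLift_flow (hσ : ∀ᶠ q in 𝓝 p, MDifferentiableAt (𝓡 d) 𝓘(ℝ, Phase n) σ q)
    (hW : MDifferentiableAt (𝓡 d) 𝓘(ℝ, Phase n) (fun q => horDeriv A μ₀ σ q (Z q)) p)
    (t : ℝ) (u : TangentSpace (𝓡 d) p) :
    connLift A μ₀ (fun q => flow A t (σ q)) Z p u = flow A t (connLift A μ₀ σ Z p u) := by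
  have h1 : (fun q => horDeriv A μ₀ (fun q => flow A t (σ q)) q (Z q))
      =ᶠ[𝓝 p] fun q => flowCLM A t (horDeriv A μ₀ σ q (Z q)) := by
    filter_upwards [hσ] with q hq
    rw [horDeriv_flow hq, flowCLM_apply]
  have h2 := mvfderiv_clm (flowCLM A t) hW u
  have h3 : mvfderiv (𝓡 d) (fun q => flow A t (σ q)) p u = flow A t (mvfderiv (𝓡 d) σ p u) := by
    simp only [← flowCLM_apply]
    exact mvfderiv_clm _ hσ.self_of_nhds u
  rw [connLift, mvfderiv_congr h1, h2]
  simp only [horDeriv_flow hσ.self_of_nhds, vertCoeff_apply, h3, omega_flow, mulVec_flow]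
  simp only [connLift, ← flowCLM_apply, map_add, map_smul, vertCoeff_apply]

variable [IsManifold (𝓡 d) ∞ M]

omit [IsManifold (𝓡 d) ∞ M] in
lemma connLift_add {Z' : VField d M}
    (hW : MDifferentiableAt (𝓡 d) 𝓘(ℝ, Phase n) (fun q => horDeriv A μ₀ σ q (Z q)) p)
    (hW' : MDifferentiableAt (𝓡 d) 𝓘(ℝ, Phase n) (fun q => horDeriv A μ₀ σ q (Z' q)) p)
    (u : TangentSpace (𝓡 d) p) :
    connLift A μ₀ σ (Z + Z') p u = connLift A μ₀ σ Z p u + connLift A μ₀ σ Z' p u := by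
  have h1 : mvfderiv (𝓡 d) (fun q => horDeriv A μ₀ σ q ((Z + Z') q)) p u
      = mvfderiv (𝓡 d) (fun q => horDeriv A μ₀ σ q (Z q)) p u
        + mvfderiv (𝓡 d) (fun q => horDeriv A μ₀ σ q (Z' q)) p u := by
    simp only [Pi.add_apply, map_add]
    exact congrArg (fun L => L u) (mvfderiv_fun_add hW hW')
  rw [connLift, h1]
  simp only [connLift, Pi.add_apply, map_add, LinearMap.add_apply, Matrix.mulVec_add, smul_add,
    mul_add, add_smul]
  abel

omit [IsManifold (𝓡 d) ∞ M] in
lemma connLift_smul {f : M → ℝ} (hf : MDifferentiableAt (𝓡 d) 𝓘(ℝ, ℝ) f p)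
    (hW : MDifferentiableAt (𝓡 d) 𝓘(ℝ, Phase n) (fun q => horDeriv A μ₀ σ q (Z q)) p)
    (u : TangentSpace (𝓡 d) p) :
    connLift A μ₀ σ (f • Z) p u
      = f p • connLift A μ₀ σ Z p u + mvfderiv (𝓡 d) f p u • horDeriv A μ₀ σ p (Z p) := by
  have h1 : mvfderiv (𝓡 d) (fun q => horDeriv A μ₀ σ q ((f • Z) q)) p u
      = f p • mvfderiv (𝓡 d) (fun q => horDeriv A μ₀ σ q (Z q)) p u
        + mvfderiv (𝓡 d) f p u • horDeriv A μ₀ σ p (Z p) := by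
    simp only [Pi.smul_apply', map_smul]
    exact congrArg (fun L => L u) (mvfderiv_fun_smul hf hW)
  rw [connLift, h1]
  simp only [connLift, Pi.smul_apply', map_smul, LinearMap.smul_apply, smul_eq_mul,
    Matrix.mulVec_smul]
  module

variable [NeZero μ₀]

/-- Differentiating `ω(Z̄, σ) = 0` gives the pairing of the derivative with `σ`, and the correction
along `Aσ` removes exactly that. -/
lemma omega_connLift_self (hl : ∀ᶠ q in 𝓝 p, ham A (σ q) = μ₀)
    (hσ : MDifferentiableAt (𝓡 d) 𝓘(ℝ, Phase n) σ p)
    (hW : MDifferentiableAt (𝓡 d) 𝓘(ℝ, Phase n) (fun q => horDeriv A μ₀ σ q (Z q)) p)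
    (u : TangentSpace (𝓡 d) p) : omega (connLift A μ₀ σ Z p u) (σ p) = 0 := by
  have h0 := NeZero.ne μ₀
  have hz : (fun q => omega (horDeriv A μ₀ σ q (Z q)) (σ q)) =ᶠ[𝓝 p] fun _ => (0 : ℝ) :=
    hl.mono fun q hq => omega_horDeriv_self hq _
  have h1 := mvfderiv_omega hW hσ u
  rw [mvfderiv_congr hz, mvfderiv_const, zero_apply] at h1
  have h2 := omega_horDeriv_mulVec hl hσ (Z p)
  have h3 : omega (σ p) (A.1 *ᵥ σ p) = μ₀ := hl.self_of_nhds
  have h4 : omega (horDeriv A μ₀ σ p u) (horDeriv A μ₀ σ p (Z p))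
      = omega (mvfderiv (𝓡 d) σ p u) (horDeriv A μ₀ σ p (Z p)) := by
    rw [horDeriv_apply A μ₀ σ p u, map_add, map_smul, LinearMap.add_apply, LinearMap.smul_apply,
      omega_neg_swap (A.1 *ᵥ σ p), h2]
    simp
  rw [omega_neg_swap (horDeriv A μ₀ σ p (Z p)) (mvfderiv (𝓡 d) σ p u)] at h1
  simp only [connLift, h4, map_add, map_smul, LinearMap.add_apply, LinearMap.smul_apply,
    smul_eq_mul, omega_self, omega_mulVec_left, h2, h3]
  field_simp
  linear_combination (-μ₀) * h1

/-- Here `ω(Z̄, Aσ) = 0` is differentiated, and the correction along `σ` removes the resulting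
pairing with `Aσ`. -/
lemma omega_connLift_mulVec (hl : ∀ᶠ q in 𝓝 p, ham A (σ q) = μ₀)
    (hσ : ∀ᶠ q in 𝓝 p, MDifferentiableAt (𝓡 d) 𝓘(ℝ, Phase n) σ q)
    (hW : MDifferentiableAt (𝓡 d) 𝓘(ℝ, Phase n) (fun q => horDeriv A μ₀ σ q (Z q)) p)
    (u : TangentSpace (𝓡 d) p) : omega (connLift A μ₀ σ Z p u) (A.1 *ᵥ σ p) = 0 := by
  have h0 := NeZero.ne μ₀
  have hz : (fun q => omega (horDeriv A μ₀ σ q (Z q)) (A.1 *ᵥ σ q)) =ᶠ[𝓝 p] fun _ => (0 : ℝ) := by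
    filter_upwards [eventually_eventually_nhds.2 hl, hσ] with q h1 h2
    exact omega_horDeriv_mulVec h1 h2 _
  have h1 := mvfderiv_omega hW (mdifferentiableAt_mulVec A hσ.self_of_nhds) u
  rw [mvfderiv_congr hz, mvfderiv_const, zero_apply, mvfderiv_mulVec A hσ.self_of_nhds] at h1
  have h3 : omega (σ p) (A.1 *ᵥ σ p) = μ₀ := hl.self_of_nhds
  have h4 : omega (horDeriv A μ₀ σ p (Z p)) (A.1 *ᵥ horDeriv A μ₀ σ p u)
      = omega (horDeriv A μ₀ σ p (Z p)) (A.1 *ᵥ mvfderiv (𝓡 d) σ p u)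
        - vertCoeff μ₀ σ p u * omega (A.1 *ᵥ horDeriv A μ₀ σ p (Z p)) (A.1 *ᵥ σ p) := by
    rw [horDeriv_apply A μ₀ σ p u, Matrix.mulVec_add, Matrix.mulVec_smul, map_add, map_smul,
      omega_mulVec_left A (horDeriv A μ₀ σ p (Z p)), smul_eq_mul]
    ring
  simp only [connLift, h4, map_add, map_smul, LinearMap.add_apply, LinearMap.smul_apply,
    smul_eq_mul, omega_self, h3]
  field_simp
  linear_combination (-μ₀) * h1

end General

variable {A : Sp n} {μ₀ : ℝ} [NeZero μ₀]
  [ChartedSpace (EuclideanSpace ℝ (Fin (2 * n))) (Reduced A μ₀)]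
  [IsManifold (𝓡 (2 * n)) ∞ (Reduced A μ₀)]
  (hπ : Manifold.IsSubmersion (𝓡 (2 * n + 1)) (𝓡 (2 * n)) ∞ (proj A μ₀))

include hπ

lemma hlift_field_eq {x : Quadric A μ₀} {y : Reduced A μ₀} (h : proj A μ₀ x = y)
    {s : Reduced A μ₀ → Quadric A μ₀} (hs : IsLocalSection s y) (hx : s y = x)
    (Z : VField (2 * n) (Reduced A μ₀)) :
    hlift A μ₀ x (Z (proj A μ₀ x)) = horDeriv A μ₀ (fun q => (s q).1) y (Z y) := by
  subst h
  exact hlift_eq_horDeriv hπ hs hx _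

/-- If `s` is a section through `x`, then `ψ_t ∘ s` is a section through `ψ_t x`, and its horizontal
derivative is the image under `ψ_t` of that of `s`. -/
lemma hlift_field_quadricFlow (t : ℝ) (x : Quadric A μ₀) (Z : VField (2 * n) (Reduced A μ₀)) :
    hlift A μ₀ (quadricFlow t x) (Z (proj A μ₀ (quadricFlow t x)))
      = flow A t (hlift A μ₀ x (Z (proj A μ₀ x))) := by
  obtain ⟨s, -, hs, hx⟩ := exists_section hπ x
  rw [hlift_field_eq hπ (proj_quadricFlow t x) (hs.quadricFlow t) (by rw [hx]),
    hlift_field_eq hπ rfl hs hx]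
  exact horDeriv_flow hs.mdifferentiableAt_coe t _

/-- One section describes the lifted field only along its image, so a family is needed. The section
through `p` depends smoothly on `p`; its derivative along `Z` is `V p`, and the lift at `p` is `V p`
plus the vertical correction. -/
lemma mdifferentiableAt_hlift {x : Quadric A μ₀} {Z : VField (2 * n) (Reduced A μ₀)}
    (hZ : DiffAt Z (proj A μ₀ x)) :
    MDifferentiableAt (𝓡 (2 * n + 1)) 𝓘(ℝ, Phase n)
      (fun p => hlift A μ₀ p (Z (proj A μ₀ p))) x := by
  obtain ⟨φ, ψ, g, L, hφ, hψ, hg, h⟩ := exists_family_sections hπ x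
  set G : EuclideanSpace ℝ (Fin (2 * n + 1)) → Phase n := fun u => (g u).1
  set V : Quadric A μ₀ → Phase n :=
    fun p => fderiv ℝ G (φ p) (L (fieldDeriv Z ψ (proj A μ₀ p))) with hV
  have hcoe : MDifferentiableAt (𝓡 (2 * n + 1)) 𝓘(ℝ, Phase n) (Subtype.val : Quadric A μ₀ → Phase n)
    x := contMDiff_coe.mdifferentiableAt (by simp)
  have hVd : MDifferentiableAt (𝓡 (2 * n + 1)) 𝓘(ℝ, Phase n) V x := by
    have h1 : ContDiffAt ℝ ∞ (fderiv ℝ G) (φ x) := hg.fderiv_right (by simp)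
    have h2 : MDifferentiableAt (𝓡 (2 * n + 1))
        𝓘(ℝ, EuclideanSpace ℝ (Fin (2 * n + 1)) →L[ℝ] Phase n) (fun p => fderiv ℝ G (φ p)) x :=
      MDifferentiableAt.comp (g := fderiv ℝ G) x
        (h1.differentiableAt (by simp)).mdifferentiableAt (hφ.mdifferentiableAt (by simp))
    refine h2.clm_apply ?_
    refine MDifferentiableAt.comp (g := L) x L.differentiable.mdifferentiable.mdifferentiableAt ?_
    exact MDifferentiableAt.comp (g := fieldDeriv Z ψ) x (mdifferentiableAt_fieldDeriv hψ hZ)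
      (mdifferentiableAt_proj hπ x)
  have hE : MDifferentiableAt (𝓡 (2 * n + 1)) 𝓘(ℝ, Phase n)
      (fun p => V p + (1 / μ₀ * omega (V p) p.1) • (A.1 *ᵥ p.1)) x :=
    hVd.add ((mdifferentiableAt_const.mul (mdifferentiableAt_omega hVd hcoe)).smul
      (mdifferentiableAt_mulVec A hcoe))
  refine hE.congr_of_eventuallyEq ?_
  have hψ' : ∀ᶠ p in 𝓝 x, MDifferentiableAt (𝓡 (2 * n)) 𝓘(ℝ, EuclideanSpace ℝ (Fin (2 * n))) ψ
      (proj A μ₀ p) :=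
    (mdifferentiableAt_proj hπ x).continuousAt.tendsto.eventually (eventually_mdifferentiableAt hψ)
  have hg' : ∀ᶠ p in 𝓝 x, DifferentiableAt ℝ G (φ p) := by
    have h1 : ContDiffAt ℝ 1 G (φ x) := hg.of_le (mod_cast le_top)
    exact (ContMDiffAt.continuousAt hφ).tendsto.eventually
      ((h1.eventually (by simp)).mono fun u hu => hu.differentiableAt (by simp))
  filter_upwards [h, hψ', hg'] with p hp hψp hgp
  obtain ⟨hp, -, hs⟩ := hp
  have hsp : g (φ p + L (ψ (proj A μ₀ p) - ψ (proj A μ₀ p))) = p := by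
    rw [sub_self, map_zero, add_zero, hp]
  have h1 := hlift_eq_horDeriv hπ hs hsp (Z (proj A μ₀ p))
  have h2 : mvfderiv (𝓡 (2 * n)) (fun q => (g (φ p + L (ψ q - ψ (proj A μ₀ p)))).1) (proj A μ₀ p)
      (Z (proj A μ₀ p)) = V p := by
    set a : EuclideanSpace ℝ (Fin (2 * n)) → EuclideanSpace ℝ (Fin (2 * n + 1)) :=
      fun w => φ p + L (w - ψ (proj A μ₀ p)) with ha
    have h3 : HasFDerivAt a L (ψ (proj A μ₀ p)) :=
      (L.hasFDerivAt.comp _ ((hasFDerivAt_id _).sub_const _)).const_add _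
    have h4 : a (ψ (proj A μ₀ p)) = φ p := by simp [ha]
    have h5 : HasFDerivAt (fun w => G (a w)) (fderiv ℝ G (φ p) ∘L L) (ψ (proj A μ₀ p)) := by
      have h6 : HasFDerivAt G (fderiv ℝ G (φ p)) (a (ψ (proj A μ₀ p))) := h4 ▸ hgp.hasFDerivAt
      exact h6.comp _ h3
    have h6 := mvfderiv_fderiv_comp (g := fun w => G (a w)) h5.differentiableAt hψp
      (Z (proj A μ₀ p))
    rw [h5.fderiv] at h6
    exact h6
  rw [h1, horDeriv_apply, vertCoeff_apply, h2]
  simp only [hsp]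

/-- The derivative of a lifted field along the orbits. -/
lemma mvfderiv_hlift_orbit {x : Quadric A μ₀} {Z : VField (2 * n) (Reduced A μ₀)}
    (hZ : DiffAt Z (proj A μ₀ x)) {v : TangentSpace (𝓡 (2 * n + 1)) x}
    (hv : incl A μ₀ x v = A.1 *ᵥ x.1) :
    mvfderiv (𝓡 (2 * n + 1)) (fun p => hlift A μ₀ p (Z (proj A μ₀ p))) x v
      = A.1 *ᵥ hlift A μ₀ x (Z (proj A μ₀ x)) := by
  refine mvfderiv_eq_of_flow (mdifferentiableAt_hlift hπ hZ) hv ?_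
  simp only [hlift_field_quadricFlow hπ]
  exact hasDerivAt_orbit A _

variable {s : Reduced A μ₀ → Quadric A μ₀} {y : Reduced A μ₀} {Z : VField (2 * n) (Reduced A μ₀)}

lemma hlift_comp_section (hs : IsLocalSection s y) (Z : VField (2 * n) (Reduced A μ₀)) :
    ((fun p => hlift A μ₀ p (Z (proj A μ₀ p))) ∘ s)
      =ᶠ[𝓝 y] fun q => horDeriv A μ₀ (fun q => (s q).1) q (Z q) := by
  filter_upwards [hs.eventually, hs.proj_eq] with q h1 h2 using hlift_field_eq hπ h2 h1 rfl Z

lemma mdifferentiableAt_horDeriv_section (hs : IsLocalSection s y) (hZ : DiffAt Z y) :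
    MDifferentiableAt (𝓡 (2 * n)) 𝓘(ℝ, Phase n)
      (fun q => horDeriv A μ₀ (fun q => (s q).1) q (Z q)) y := by
  refine MDifferentiableAt.congr_of_eventuallyEq ?_ (hlift_comp_section hπ hs Z).symm
  have hy := hs.proj_eq.self_of_nhds
  refine MDifferentiableAt.comp y (mdifferentiableAt_hlift hπ ?_) hs.mdifferentiableAt
  rwa [hy]

/-- The lift of the reduced connection, in terms of a local section. -/
lemma quadricConnection_eq_connLift {x : Quadric A μ₀} (hs : IsLocalSection s (proj A μ₀ x))
    (hx : s (proj A μ₀ x) = x) (hZ : DiffAt Z (proj A μ₀ x))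
    (u : TangentSpace (𝓡 (2 * n)) (proj A μ₀ x)) :
    quadricConnection A μ₀ (liftField A μ₀ Z) x (lift A μ₀ x u)
          + (1 / μ₀ * omega (hlift A μ₀ x u) (hlift A μ₀ x (Z (proj A μ₀ x)))) • (A.1 *ᵥ x.1)
      = connLift A μ₀ (fun q => (s q).1) Z (proj A μ₀ x) u := by
  obtain ⟨v, hv⟩ := exists_incl_eq_mulVec x
  have h1 : mvfderiv (𝓡 (2 * n + 1)) (fun p => hlift A μ₀ p (Z (proj A μ₀ p))) x
      (sectionDeriv s x u)
      = mvfderiv (𝓡 (2 * n)) (fun q => horDeriv A μ₀ (fun q => (s q).1) q (Z q))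
        (proj A μ₀ x) u := by
    rw [← mvfderiv_congr (hlift_comp_section hπ hs Z)]
    exact (mvfderiv_comp_mfderiv hx (mdifferentiableAt_hlift hπ hZ) hs.mdifferentiableAt u).symm
  -- The lift of `u` is the derivative of the section plus `c(u)` times the vertical vector. The
  -- first part differentiates the field along the section, and the second gives `c(u) A Z̄` by
  -- invariance under the flow.
  have h2 : mvfderiv (𝓡 (2 * n + 1)) (fun p => hlift A μ₀ p (Z (proj A μ₀ p))) x (lift A μ₀ x u)
      = mvfderiv (𝓡 (2 * n)) (fun q => horDeriv A μ₀ (fun q => (s q).1) q (Z q))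
        (proj A μ₀ x) u + vertCoeff μ₀ (fun q => (s q).1) (proj A μ₀ x) u •
          (A.1 *ᵥ hlift A μ₀ x (Z (proj A μ₀ x))) := by
    rw [lift_eq hπ hs hx hv, map_add, map_smul, h1, mvfderiv_hlift_orbit hπ hZ hv]
  have h3 : quadricConnection A μ₀ (liftField A μ₀ Z) x (lift A μ₀ x u)
      = mvfderiv (𝓡 (2 * n + 1)) (fun p => hlift A μ₀ p (Z (proj A μ₀ p))) x (lift A μ₀ x u)
        + (1 / μ₀ * omega (hlift A μ₀ x (Z (proj A μ₀ x))) (A.1 *ᵥ hlift A μ₀ x u)) • x.1 := rfl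
  rw [h3, h2, hlift_eq_horDeriv hπ hs hx, hlift_eq_horDeriv hπ hs hx, connLift]
  simp only [hx]

end ConnectionLift

/-! ### Existence of the reduced objects and their local models -/

section ReducedExistence

open Filter Topology

variable {A : Sp n} {μ₀ : ℝ} [NeZero μ₀]
  [ChartedSpace (EuclideanSpace ℝ (Fin (2 * n))) (Reduced A μ₀)]
  [IsManifold (𝓡 (2 * n)) ∞ (Reduced A μ₀)]
  (hπ : Manifold.IsSubmersion (𝓡 (2 * n + 1)) (𝓡 (2 * n)) ∞ (proj A μ₀))

include hπ

variable {s s' : Reduced A μ₀ → Quadric A μ₀} {y : Reduced A μ₀}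

lemma exists_section_at (y : Reduced A μ₀) : ∃ s : Reduced A μ₀ → Quadric A μ₀,
    ContMDiffAt (𝓡 (2 * n)) 𝓘(ℝ, Phase n) ∞ (fun q => (s q).1) y ∧ IsLocalSection s y := by
  obtain ⟨x, rfl⟩ := proj_surjective y
  obtain ⟨s, h1, h2, -⟩ := exists_section hπ x
  exact ⟨s, h1, h2⟩

/-- Two local sections over the same point differ by the flow. -/
lemma exists_section_flow (hs : IsLocalSection s y) (hs' : IsLocalSection s' y) :
    ∃ t, quadricFlow t (s y) = s' y ∧
      (∀ u : TangentSpace (𝓡 (2 * n)) y, horDeriv A μ₀ (fun q => (s' q).1) y u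
        = flow A t (horDeriv A μ₀ (fun q => (s q).1) y u)) ∧
      ∀ Z : VField (2 * n) (Reduced A μ₀), DiffAt Z y → ∀ u : TangentSpace (𝓡 (2 * n)) y,
        connLift A μ₀ (fun q => (s' q).1) Z y u
          = flow A t (connLift A μ₀ (fun q => (s q).1) Z y u) := by
  obtain ⟨t, ht⟩ := exists_quadricFlow_eq (hs.proj_eq.self_of_nhds.trans
    hs'.proj_eq.self_of_nhds.symm)
  -- Both `s'` and `ψ_t ∘ s` pass through `s' y`, and the lifts depend only on that point. The free
  -- variable `x` allows `y` to be replaced by `π x`, which identifies two tangent spaces that are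
  -- different types.
  have key : ∀ (x : Quadric A μ₀), s' y = x → proj A μ₀ x = y →
      (∀ u : TangentSpace (𝓡 (2 * n)) y, horDeriv A μ₀ (fun q => (s' q).1) y u
        = horDeriv A μ₀ (fun q => (quadricFlow t (s q)).1) y u) ∧
      ∀ Z : VField (2 * n) (Reduced A μ₀), DiffAt Z y → ∀ u : TangentSpace (𝓡 (2 * n)) y,
        connLift A μ₀ (fun q => (s' q).1) Z y u
          = connLift A μ₀ (fun q => (quadricFlow t (s q)).1) Z y u := by
    rintro x hx rfl
    refine ⟨fun u => ?_, fun Z hZ u => ?_⟩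
    · rw [← hlift_eq_horDeriv hπ hs' hx,
        ← hlift_eq_horDeriv hπ (hs.quadricFlow t) (ht.trans hx)]
    · rw [← quadricConnection_eq_connLift hπ hs' hx hZ,
        ← quadricConnection_eq_connLift hπ (hs.quadricFlow t) (ht.trans hx) hZ]
  obtain ⟨h1, h2⟩ := key _ rfl hs'.proj_eq.self_of_nhds
  refine ⟨t, ht, fun u => ?_, fun Z hZ u => ?_⟩
  · rw [h1]
    exact horDeriv_flow hs.mdifferentiableAt_coe t u
  · rw [h2 Z hZ]
    exact connLift_flow hs.eventually_mdifferentiableAt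
      (mdifferentiableAt_horDeriv_section hπ hs hZ) t u

lemma horDeriv_section_injective (hs : IsLocalSection s y) :
    Function.Injective (horDeriv (d := 2 * n) A μ₀ (fun q => (s q).1) y) := by
  have key : ∀ (x : Quadric A μ₀), s y = x → proj A μ₀ x = y →
      Function.Injective (horDeriv (d := 2 * n) A μ₀ (fun q => (s q).1) y) := by
    rintro x hx rfl u v h
    apply hlift_injective hπ x
    rwa [hlift_eq_horDeriv hπ hs hx, hlift_eq_horDeriv hπ hs hx]
  exact key _ rfl hs.proj_eq.self_of_nhds

lemma exists_horDeriv_section_eq (hs : IsLocalSection s y) {w : Phase n}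
    (h1 : omega w (s y).1 = 0) (h2 : omega w (A.1 *ᵥ (s y).1) = 0) :
    ∃ u : TangentSpace (𝓡 (2 * n)) y, horDeriv A μ₀ (fun q => (s q).1) y u = w := by
  have key : ∀ (x : Quadric A μ₀), s y = x → proj A μ₀ x = y →
      ∃ u : TangentSpace (𝓡 (2 * n)) y, horDeriv A μ₀ (fun q => (s q).1) y u = w := by
    rintro x hx rfl
    rw [hx] at h1 h2
    obtain ⟨u, hu⟩ := exists_hlift_eq hπ x h1 h2
    exact ⟨u, (hlift_eq_horDeriv hπ hs hx u).symm.trans hu⟩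
  exact key _ rfl hs.proj_eq.self_of_nhds

omit hπ in
lemma omega_horDeriv_section (hs : IsLocalSection s y) (u : TangentSpace (𝓡 (2 * n)) y) :
    omega (horDeriv A μ₀ (fun q => (s q).1) y u) (s y).1 = 0 ∧
      omega (horDeriv A μ₀ (fun q => (s q).1) y u) (A.1 *ᵥ (s y).1) = 0 :=
  ⟨omega_horDeriv_self (σ := fun q => (s q).1) (s y).2 u,
    omega_horDeriv_mulVec (σ := fun q => (s q).1) (Eventually.of_forall fun q => (s q).2)
      hs.mdifferentiableAt_coe u⟩

/-- A linear left inverse of the horizontal lift takes horizontal vectors to the vectors they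
represent. -/
lemma exists_clm_horDeriv_section (hs : IsLocalSection s y) :
    ∃ P : Phase n →L[ℝ] TangentSpace (𝓡 (2 * n)) y, ∀ w, omega w (s y).1 = 0 →
      omega w (A.1 *ᵥ (s y).1) = 0 → horDeriv A μ₀ (fun q => (s q).1) y (P w) = w := by
  obtain ⟨P, hP⟩ := LinearMap.exists_leftInverse_of_injective
    (horDeriv A μ₀ (fun q => (s q).1) y)
    (LinearMap.ker_eq_bot.2 (horDeriv_section_injective hπ hs))
  refine ⟨LinearMap.toContinuousLinearMap
    (show Phase n →ₗ[ℝ] EuclideanSpace ℝ (Fin (2 * n)) from P), fun w h1 h2 => ?_⟩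
  obtain ⟨u, rfl⟩ := exists_horDeriv_section_eq hπ hs h1 h2
  exact congrArg _ (congrArg (fun L => L u) hP)

/-- The definition is pointwise, with unrelated sections at different points. Independence of the
choice is the invariance of `ω` under the flow. -/
theorem exists_isReducedForm : ∃ Ω, IsReducedForm A μ₀ Ω := by
  choose s _ hs using exists_section_at hπ
  refine ⟨fun y => omega.compl₁₂ (horDeriv A μ₀ (fun q => (s y q).1) y)
    (horDeriv A μ₀ (fun q => (s y q).1) y), fun x u v => ?_⟩
  obtain ⟨s', -, hs', hx⟩ := exists_section hπ x
  obtain ⟨t, -, h, -⟩ := exists_section_flow hπ (hs (proj A μ₀ x)) hs'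
  rw [hlift_eq_horDeriv hπ hs' hx, hlift_eq_horDeriv hπ hs' hx, h, h, omega_flow]
  rfl

theorem exists_isInducedEnd : ∃ B, IsInducedEnd A μ₀ B := by
  choose s _ hs using exists_section_at hπ
  choose P hP using fun y => exists_clm_horDeriv_section hπ (hs y)
  let C : (y : Reduced A μ₀) → TangentSpace (𝓡 (2 * n)) y →ₗ[ℝ] Phase n := fun y =>
    (Matrix.toLin' A.1 - ((1 / μ₀) • ((omega.flip (A.1 *ᵥ (s y y).1)) ∘ₗ
      Matrix.toLin' A.1)).smulRight (s y y).1) ∘ₗ horDeriv A μ₀ (fun q => (s y q).1) y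
  have hC : ∀ y u, C y u = A.1 *ᵥ horDeriv A μ₀ (fun q => (s y q).1) y u
      - (1 / μ₀ * omega (A.1 *ᵥ horDeriv A μ₀ (fun q => (s y q).1) y u) (A.1 *ᵥ (s y y).1)) •
        (s y y).1 := fun y u => by
    simp [C]
  refine ⟨fun y => (P y).toLinearMap ∘ₗ C y, fun x => ?_⟩
  obtain ⟨s', -, hs', hx⟩ := exists_section hπ x
  set y := proj A μ₀ x with hy
  intro u
  obtain ⟨t, ht, h, -⟩ := exists_section_flow hπ (hs y) hs'
  have hx' : x.1 = flow A t (s y y).1 := by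
    rw [← hx, ← ht]; rfl
  have h0 := NeZero.ne μ₀
  have hm : omega (s y y).1 (A.1 *ᵥ (s y y).1) = μ₀ := (s y y).2
  obtain ⟨h1, h2⟩ := omega_horDeriv_section (hs y) u
  rw [hlift_eq_horDeriv hπ hs' hx, hlift_eq_horDeriv hπ hs' hx, h, h, hx']
  simp only [mulVec_flow, omega_flow]
  change flow A t (horDeriv A μ₀ (fun q => (s y q).1) y (P y (C y u))) = _
  -- `P` inverts the lift only on horizontal vectors; the last two goals check that `C y u` is
  -- horizontal.
  rw [hP y, hC]
  · simp only [← flowCLM_apply, map_sub, map_smul]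
  · rw [hC]
    simp only [map_sub, map_smul, LinearMap.sub_apply, LinearMap.smul_apply, smul_eq_mul,
      omega_self, omega_mulVec_left, h2]
    ring
  · rw [hC]
    simp only [map_sub, map_smul, LinearMap.sub_apply, LinearMap.smul_apply, smul_eq_mul, hm]
    field_simp
    ring

/-- The vector `connLift` is horizontal, so it is a lift, and the flow intertwines its values for
different sections. Hence one operator serves all sections over `y`; nothing is claimed for `Z` not
differentiable at `y`. -/
lemma exists_connection_at (y : Reduced A μ₀) :
    ∃ D : VField (2 * n) (Reduced A μ₀) →
      TangentSpace (𝓡 (2 * n)) y →L[ℝ] TangentSpace (𝓡 (2 * n)) y,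
      ∀ s, IsLocalSection s y → ∀ Z, DiffAt Z y → ∀ u,
        horDeriv A μ₀ (fun q => (s q).1) y (D Z u) = connLift A μ₀ (fun q => (s q).1) Z y u := by
  obtain ⟨s, -, hs⟩ := exists_section_at hπ y
  obtain ⟨P, hP⟩ := exists_clm_horDeriv_section hπ hs
  let C : VField (2 * n) (Reduced A μ₀) → TangentSpace (𝓡 (2 * n)) y →ₗ[ℝ] Phase n := fun Z =>
    { toFun := connLift A μ₀ (fun q => (s q).1) Z y
      map_add' := fun u v => by
        simp only [connLift, map_add, LinearMap.add_apply, Matrix.mulVec_add]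
        module
      map_smul' := fun c u => by
        simp only [connLift, map_smul, LinearMap.smul_apply, Matrix.mulVec_smul, smul_eq_mul,
          RingHom.id_apply]
        module }
  have : T2Space (TangentSpace (𝓡 (2 * n)) y) :=
    inferInstanceAs (T2Space (EuclideanSpace ℝ (Fin (2 * n))))
  have : FiniteDimensional ℝ (TangentSpace (𝓡 (2 * n)) y) :=
    inferInstanceAs (FiniteDimensional ℝ (EuclideanSpace ℝ (Fin (2 * n))))
  refine ⟨fun Z => P ∘L LinearMap.toContinuousLinearMap (C Z), fun s' hs' Z hZ u => ?_⟩
  obtain ⟨t, -, h1, h2⟩ := exists_section_flow hπ hs hs'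
  have hW := mdifferentiableAt_horDeriv_section hπ hs hZ
  have hl : ∀ᶠ q in 𝓝 y, ham A (s q).1 = μ₀ := Eventually.of_forall fun q => (s q).2
  rw [h1, h2 Z hZ]
  congr 1
  exact hP _ (omega_connLift_self hl hs.mdifferentiableAt_coe hW u)
    (omega_connLift_mulVec hl hs.eventually_mdifferentiableAt hW u)

theorem exists_isReducedConnection : ∃ D, IsReducedConnection A μ₀ D := by
  choose D hD using exists_connection_at hπ
  choose s _ hs using exists_section_at hπ
  -- Additivity and the Leibniz rule are verified after applying the injective horizontal
  -- derivative, where they are properties of `connLift`.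
  refine ⟨⟨fun Z y => D y Z, ⟨?_, ?_⟩⟩, ?_⟩
  · intro Z Z' y hZ hZ' _
    ext1 u
    have hZZ : DiffAt (Z + Z') y := mdifferentiableAt_add_section hZ hZ'
    apply horDeriv_section_injective hπ (hs y)
    rw [hD y _ (hs y) _ hZZ, add_apply, map_add, hD y _ (hs y) _ hZ, hD y _ (hs y) _ hZ']
    exact connLift_add (mdifferentiableAt_horDeriv_section hπ (hs y) hZ)
      (mdifferentiableAt_horDeriv_section hπ (hs y) hZ') u
  · intro Z f y hZ hf _
    ext1 u
    have hfZ : DiffAt (f • Z) y := MDifferentiableAt.smul_section hf hZ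
    apply horDeriv_section_injective hπ (hs y)
    rw [hD y _ (hs y) _ hfZ]
    refine (connLift_smul hf (mdifferentiableAt_horDeriv_section hπ (hs y) hZ) u).trans ?_
    rw [← hD y _ (hs y) _ hZ]
    refine Eq.trans ?_ (map_add (horDeriv A μ₀ (fun q => (s y q).1) y) (f y • D y Z u)
      (mvfderiv (𝓡 (2 * n)) f y u • Z y)).symm
    rw [map_smul, map_smul]
  · intro x Z hZ u
    obtain ⟨s', -, hs', hx⟩ := exists_section hπ x
    rw [quadricConnection_eq_connLift hπ hs' hx hZ, hlift_eq_horDeriv hπ hs' hx]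
    exact hD _ s' hs' Z hZ u

/-- The reduced objects have local models. -/
theorem exists_isLocalModel {Ω : BilinField (2 * n) (Reduced A μ₀)}
    {B : EndField (2 * n) (Reduced A μ₀)} {D : Connection (2 * n) (Reduced A μ₀)}
    (hΩ : IsReducedForm A μ₀ Ω) (hB : IsInducedEnd A μ₀ B) (hD : IsReducedConnection A μ₀ D)
    (y : Reduced A μ₀) : ∃ σ, IsLocalModel A μ₀ σ Ω B D y := by
  obtain ⟨s, hsm, hs⟩ := exists_section_at hπ y
  have hΩ' : ∀ (x : Quadric A μ₀) (p : Reduced A μ₀), proj A μ₀ x = p → IsLocalSection s p →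
      s p = x → ∀ u v, Ω p u v = omega (horDeriv A μ₀ (fun q => (s q).1) p u)
        (horDeriv A μ₀ (fun q => (s q).1) p v) := by
    rintro x _ rfl h hx u v
    rw [← hlift_eq_horDeriv hπ h hx, ← hlift_eq_horDeriv hπ h hx, hΩ]
  have hB' : ∀ (x : Quadric A μ₀) (p : Reduced A μ₀), proj A μ₀ x = p → IsLocalSection s p →
      s p = x → ∀ u, horDeriv A μ₀ (fun q => (s q).1) p (B p u)
        = A.1 *ᵥ horDeriv A μ₀ (fun q => (s q).1) p u
          - (1 / μ₀ * omega (A.1 *ᵥ horDeriv A μ₀ (fun q => (s q).1) p u) (A.1 *ᵥ x.1)) • x.1 := by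
    rintro x _ rfl h hx u
    rw [← hlift_eq_horDeriv hπ h hx, ← hlift_eq_horDeriv hπ h hx, hB]
  have hD' : ∀ (x : Quadric A μ₀) (p : Reduced A μ₀), proj A μ₀ x = p → IsLocalSection s p →
      s p = x → ∀ Z : VField (2 * n) (Reduced A μ₀), DiffAt Z p → ∀ u,
        horDeriv A μ₀ (fun q => (s q).1) p (D Z p u)
          = connLift A μ₀ (fun q => (s q).1) Z p u := by
    rintro x _ rfl h hx Z hZ u
    rw [← hlift_eq_horDeriv hπ h hx, hD x Z hZ, quadricConnection_eq_connLift hπ h hx hZ]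
  have hy := hs.proj_eq.self_of_nhds
  refine ⟨fun q => (s q).1, hsm, Eventually.of_forall fun q => (s q).2,
    horDeriv_section_injective hπ hs, fun w => exists_horDeriv_section_eq hπ hs, ?_,
    hB' _ y hy hs rfl, ?_⟩
  · filter_upwards [hs.eventually, hs.proj_eq] with p h1 h2 using hΩ' _ p h2 h1 rfl
  · filter_upwards [hs.eventually, hs.proj_eq] with p h1 h2 using hD' _ p h2 h1 rfl

end ReducedExistence

end SymplecticReduction

end

theorem mainTheorem1 (n : ℕ) (A : SymplecticReduction.Sp n) (hA : A ≠ 0) (μ₀ : ℝ) [NeZero μ₀]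
    [ChartedSpace (EuclideanSpace ℝ (Fin (2 * n))) (SymplecticReduction.Reduced A μ₀)]
    [IsManifold (𝓡 (2 * n)) ∞ (SymplecticReduction.Reduced A μ₀)]
    [T2Space (SymplecticReduction.Reduced A μ₀)]
    (hπ : Manifold.IsSubmersion (𝓡 (2 * n + 1)) (𝓡 (2 * n)) ∞ (SymplecticReduction.proj A μ₀)) :
    (∀ x : SymplecticReduction.Quadric A μ₀, Function.Bijective
      (SymplecticReduction.dproj A μ₀ x ∘L (SymplecticReduction.horizontal A μ₀ x).subtypeL)) ∧
    (∃ Ω, SymplecticReduction.IsReducedForm A μ₀ Ω) ∧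
    (∃ B, SymplecticReduction.IsInducedEnd A μ₀ B) ∧
    (∃ D, SymplecticReduction.IsReducedConnection A μ₀ D) ∧
    ∀ Ω B D, SymplecticReduction.IsReducedForm A μ₀ Ω → SymplecticReduction.IsInducedEnd A μ₀ B →
      SymplecticReduction.IsReducedConnection A μ₀ D →
      SymplecticReduction.IsSymplecticForm Ω ∧
      SymplecticReduction.IsSymplecticConnection Ω D ∧
      (∀ y u v, Ω y (B y u) v = - Ω y u (B y v)) ∧
      ∃ R, SymplecticReduction.IsCurvatureTensor D R ∧
        (∀ y, SymplecticReduction.IsRicciType (Ω y) (R y)) ∧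
        ∀ y Y Z T, R y Y Z T = (1 / μ₀) •
          (Ω y Z T • B y Y - Ω y Y T • B y Z - (2 * Ω y Y Z) • B y T
            + Ω y T (B y Z) • Y - Ω y T (B y Y) • Z) := by
  refine ⟨SymplecticReduction.dproj_horizontal_bijective hπ,
    SymplecticReduction.exists_isReducedForm hπ, SymplecticReduction.exists_isInducedEnd hπ,
    SymplecticReduction.exists_isReducedConnection hπ, fun Ω B D hΩ hB hD => ?_⟩
  choose σ h using SymplecticReduction.exists_isLocalModel hπ hΩ hB hD
  -- The tensor `R` is taken to be the explicit expression itself, so the last formula is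
  -- definitional and the content is that this expression is the curvature of `D`.
  refine ⟨⟨fun y => (h y).alternating, fun y => (h y).nondegenerate,
    fun y X Y => (h y).form_smooth, fun y X Y Z => (h y).form_closed⟩,
    ⟨fun y X Y => (h y).smoothAt_nabla, fun y X Y => (h y).torsion_free,
    fun y X Y Z _ => (h y).parallel X⟩, fun y => (h y).endo_skew,
    fun y => SymplecticReduction.endoCurvature (Ω y) (B y) (1 / μ₀),
    fun y X Y Z => (h y).curvature, fun y => ?_, fun y X Y Z => rfl⟩
  have : FiniteDimensional ℝ (TangentSpace (𝓡 (2 * n)) y) :=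
    inferInstanceAs (FiniteDimensional ℝ (EuclideanSpace ℝ (Fin (2 * n))))
  exact SymplecticReduction.isRicciType_endoCurvature (h y).alternating (h y).nondegenerate
    (h y).endo_skew _
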